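/- Let $C\subset\mathbb{P}^2=\mathbb{P}^2(\mathbb{C})$ be a smooth cubic curve, that is, the zero locus of a homogeneous polynomial $f\in\mathbb{C}[x_0,x_1,x_2]$ of degree $3$ such that at every point of $C$ at least one of the partial derivatives $\partial f/\partial x_i$ is nonzero. Then the complex surface $X=\mathbb{P}^2\setminus C$ is (holomorphically) dominable by $\mathbb{C}^2$: there is a holomorphic map $F:\mathbb{C}^2\to X$ whose Jacobian determinant $\det(DF)$ (computed in local holomorphic coordinates of $X$) is not identically zero. -/

import Mathlib

open scoped LinearAlgebra.Projectivization Manifold ContDiff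

noncomputable section

namespace ComplexProjective

/-- The complex projective space `ℙⁿ`: the space of lines through the origin of `ℂⁿ⁺¹`. -/
abbrev Pn (n : ℕ) : Type := ℙ ℂ (Fin (n + 1) → ℂ)

/-- The quotient topology of `ℂⁿ⁺¹ ∖ {0} → ℙⁿ`. -/
instance instTopologicalSpacePn (n : ℕ) : TopologicalSpace (Pn n) :=
  TopologicalSpace.coinduced
    (fun v : {v : Fin (n + 1) → ℂ // v ≠ 0} => Projectivization.mk ℂ v.1 v.2) inferInstance

/-- The projection `ℂⁿ⁺¹ ∖ {0} → ℙⁿ`. -/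
def proj (n : ℕ) (v : {v : Fin (n + 1) → ℂ // v ≠ 0}) : Pn n := Projectivization.mk ℂ v.1 v.2

theorem isQuotientMap_proj (n : ℕ) : Topology.IsQuotientMap (proj n) :=
  ⟨⟨rfl⟩, fun P => ⟨⟨P.rep, P.rep_nonzero⟩, P.mk_rep⟩⟩

theorem continuous_coord {n : ℕ} (i : Fin (n + 1)) :
    Continuous (fun v : {v : Fin (n + 1) → ℂ // v ≠ 0} => v.1 i) :=
  (continuous_apply i).comp continuous_subtype_val

theorem proj_eq_iff {n : ℕ} (v w : {v : Fin (n + 1) → ℂ // v ≠ 0}) :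
    proj n v = proj n w ↔ ∃ a : ℂ, a ≠ 0 ∧ a • w.1 = v.1 := by
  rw [proj, proj, Projectivization.mk_eq_mk_iff]
  constructor
  · rintro ⟨a, ha⟩
    exact ⟨a, a.ne_zero, ha⟩
  · rintro ⟨a, ha, h⟩
    exact ⟨Units.mk0 a ha, h⟩

/-! ### The affine charts -/

/-- The affine coordinates `(v₀ / vᵢ, …, vₙ / vᵢ)` (with the `i`-th entry left out) of the point
`[v₀ : … : vₙ]`. -/
def affineCoord {n : ℕ} (i : Fin (n + 1)) : Pn n → Fin n → ℂ :=
  Projectivization.lift (fun v j => v.1 (i.succAbove j) / v.1 i) (by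
    intro a b t h
    have ht : t ≠ 0 := by
      rintro rfl
      exact a.2 (by simpa using h)
    funext j
    simp only [h, Pi.smul_apply, smul_eq_mul]
    exact mul_div_mul_left _ _ ht)

@[simp] theorem affineCoord_proj {n : ℕ} (i : Fin (n + 1)) (v : {v : Fin (n + 1) → ℂ // v ≠ 0})
    (j : Fin n) : affineCoord i (proj n v) j = v.1 (i.succAbove j) / v.1 i := rfl

/-- The set of the points `[v₀ : … : vₙ]` with `vᵢ ≠ 0`. -/
def affineOpen {n : ℕ} (i : Fin (n + 1)) : Set (Pn n) := {P | P.rep i ≠ 0}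

theorem proj_mem_affineOpen {n : ℕ} (i : Fin (n + 1)) (v : {v : Fin (n + 1) → ℂ // v ≠ 0}) :
    proj n v ∈ affineOpen i ↔ v.1 i ≠ 0 := by
  obtain ⟨a, ha, h⟩ := (proj_eq_iff ⟨(proj n v).rep, (proj n v).rep_nonzero⟩ v).1
    (Projectivization.mk_rep _)
  have h' : (proj n v).rep i = a * v.1 i := (congrFun h i).symm
  simp [affineOpen, h', ha]

theorem insertNth_one_ne_zero {n : ℕ} (i : Fin (n + 1)) (w : Fin n → ℂ) :
    (i.insertNth (1 : ℂ) w : Fin (n + 1) → ℂ) ≠ 0 := by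
  intro h
  simpa using congrFun h i

/-- The point of `ℙⁿ` with `i`-th homogeneous coordinate `1` and the other ones given by `w`. -/
def affinePoint {n : ℕ} (i : Fin (n + 1)) (w : Fin n → ℂ) : Pn n :=
  proj n ⟨i.insertNth (1 : ℂ) w, insertNth_one_ne_zero i w⟩

theorem isOpen_affineOpen {n : ℕ} (i : Fin (n + 1)) : IsOpen (affineOpen (n := n) i) := by
  rw [← (isQuotientMap_proj n).isOpen_preimage]
  have : proj n ⁻¹' affineOpen i = {v | v.1 i ≠ 0} := by
    ext v
    exact proj_mem_affineOpen i v
  rw [this]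
  exact isOpen_ne_fun (continuous_coord i) continuous_const

theorem continuous_affinePoint {n : ℕ} (i : Fin (n + 1)) : Continuous (affinePoint (n := n) i) := by
  refine (isQuotientMap_proj n).continuous.comp (Continuous.subtype_mk ?_ _)
  exact continuous_const.finInsertNth i continuous_id

theorem continuousOn_affineCoord {n : ℕ} (i : Fin (n + 1)) :
    ContinuousOn (affineCoord (n := n) i) (affineOpen i) := by
  rw [(isQuotientMap_proj n).continuousOn_isOpen_iff (isOpen_affineOpen i)]
  rw [continuousOn_pi]
  intro j
  simp only [Function.comp_apply, affineCoord_proj]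
  refine (continuous_coord _).continuousOn.div (continuous_coord i).continuousOn ?_
  intro v hv
  exact (proj_mem_affineOpen i v).1 hv

/-- The standard affine chart `{vᵢ ≠ 0} → ℂⁿ` of `ℙⁿ`. -/
def affineChart {n : ℕ} (i : Fin (n + 1)) : OpenPartialHomeomorph (Pn n) (Fin n → ℂ) where
  toFun := affineCoord i
  invFun := affinePoint i
  source := affineOpen i
  target := Set.univ
  map_source' _ _ := Set.mem_univ _
  map_target' w _ := (proj_mem_affineOpen i _).2 (by simp)
  left_inv' P hP := by
    obtain ⟨v, rfl⟩ := (isQuotientMap_proj n).surjective P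
    have hv := (proj_mem_affineOpen i v).1 hP
    refine (proj_eq_iff _ _).2 ⟨(v.1 i)⁻¹, inv_ne_zero hv, ?_⟩
    funext k
    refine Fin.succAboveCases i ?_ (fun j => ?_) k
    · simp [hv]
    · simp [div_eq_inv_mul]
  right_inv' w _ := by
    funext j
    simp [affinePoint]
  open_source := isOpen_affineOpen i
  open_target := isOpen_univ
  continuousOn_toFun := continuousOn_affineCoord i
  continuousOn_invFun := (continuous_affinePoint i).continuousOn

theorem exists_mem_affineOpen {n : ℕ} (P : Pn n) : ∃ i : Fin (n + 1), P ∈ affineOpen i :=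
  Function.ne_iff.1 P.rep_nonzero

/-- The atlas of `ℙⁿ` that consists of the `n + 1` standard affine charts. -/
instance instChartedSpacePn (n : ℕ) : ChartedSpace (Fin n → ℂ) (Pn n) where
  atlas := Set.range affineChart
  chartAt P := affineChart (exists_mem_affineOpen P).choose
  mem_chart_source P := (exists_mem_affineOpen P).choose_spec
  chart_mem_atlas _ := ⟨_, rfl⟩

/-- The transition maps are holomorphic: `ℙⁿ` is a complex manifold. -/
instance instIsManifoldPn (n : ℕ) : IsManifold 𝓘(ℂ, Fin n → ℂ) ω (Pn n) := by
  apply isManifold_of_contDiffOn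
  rintro _ _ ⟨i, rfl⟩ ⟨j, rfl⟩
  have hins : ∀ k : Fin (n + 1), ContDiff ℂ ω
      (fun w : Fin n → ℂ => (i.insertNth (1 : ℂ) w : Fin (n + 1) → ℂ) k) := by
    intro k
    refine Fin.succAboveCases i ?_ (fun l => ?_) k
    · simpa using contDiff_const
    · simpa using contDiff_apply ℂ ℂ l
  have key : ContDiffOn ℂ ω
      (fun (w : Fin n → ℂ) (k : Fin n) =>
        (i.insertNth (1 : ℂ) w : Fin (n + 1) → ℂ) (j.succAbove k) /
          (i.insertNth (1 : ℂ) w : Fin (n + 1) → ℂ) j)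
      {w | (i.insertNth (1 : ℂ) w : Fin (n + 1) → ℂ) j ≠ 0} := by
    rw [contDiffOn_pi]
    intro k
    exact (hins _).contDiffOn.div (hins _).contDiffOn fun w hw => hw
  refine ContDiffOn.mono (f := _) key ?_
  intro w hw
  simp only [mfld_simps] at hw
  exact (proj_mem_affineOpen j _).1 hw.2

/-! ### Plane curves -/

/-- The zero locus in `ℙⁿ` of a polynomial `f`: the points all of whose homogeneous coordinate
vectors `v` satisfy `f(v) = 0`. (If `f` is homogeneous, one coordinate vector suffices.) -/
def zeroLocus {n : ℕ} (f : MvPolynomial (Fin (n + 1)) ℂ) : Set (Pn n) :=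
  {P | ∀ (v : Fin (n + 1) → ℂ) (hv : v ≠ 0),
    Projectivization.mk ℂ v hv = P → MvPolynomial.eval v f = 0}

theorem isClosed_zeroLocus {n : ℕ} (f : MvPolynomial (Fin (n + 1)) ℂ) :
    IsClosed (zeroLocus f) := by
  rw [← (isQuotientMap_proj n).isClosed_preimage]
  have : proj n ⁻¹' zeroLocus f =
      ⋂ a : {a : ℂ // a ≠ 0}, {v | MvPolynomial.eval (a.1 • v.1) f = 0} := by
    ext v
    simp only [Set.mem_preimage, Set.mem_iInter, Set.mem_ofPred_eq]
    constructor
    · intro h a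
      exact h _ (smul_ne_zero a.2 v.2) ((proj_eq_iff ⟨_, smul_ne_zero a.2 v.2⟩ v).2 ⟨a.1, a.2, rfl⟩)
    · intro h w hw hwv
      obtain ⟨a, ha, e⟩ := (proj_eq_iff ⟨w, hw⟩ v).1 hwv
      have := h ⟨a, ha⟩
      rwa [e] at this
  rw [this]
  refine isClosed_iInter fun a => isClosed_eq ?_ continuous_const
  exact (MvPolynomial.continuous_eval f).comp (continuous_subtype_val.const_smul a.1)

/-- A set `C ⊆ ℙ²` is a smooth curve of degree `d` if it is the zero locus of a homogeneous
polynomial `f` of degree `d` whose three partial derivatives have no common zero on `C`. -/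
def IsSmoothPlaneCurve (d : ℕ) (C : Set (Pn 2)) : Prop :=
  ∃ f : MvPolynomial (Fin 3) ℂ, f.IsHomogeneous d ∧ C = zeroLocus f ∧
    ∀ v : Fin 3 → ℂ, v ≠ 0 → MvPolynomial.eval v f = 0 →
      ∃ i, MvPolynomial.eval v (MvPolynomial.pderiv i f) ≠ 0

theorem IsSmoothPlaneCurve.isClosed {d : ℕ} {C : Set (Pn 2)} (h : IsSmoothPlaneCurve d C) :
    IsClosed C := by
  obtain ⟨f, -, rfl, -⟩ := h
  exact isClosed_zeroLocus f

end ComplexProjective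

/-- An `n`-dimensional complex manifold `M` is dominable by `ℂⁿ` if there is a holomorphic map
`F : ℂⁿ → M` whose Jacobian determinant (computed in charts of `M`) is not identically zero. -/
def IsDominable (n : ℕ) (M : Type*) [TopologicalSpace M] [ChartedSpace (Fin n → ℂ) M]
    [IsManifold 𝓘(ℂ, Fin n → ℂ) ω M] : Prop :=
  ∃ F : (Fin n → ℂ) → M,
    MDifferentiable 𝓘(ℂ, Fin n → ℂ) 𝓘(ℂ, Fin n → ℂ) F ∧
    ∃ z : Fin n → ℂ,
      ContinuousLinearMap.det
        (mfderiv 𝓘(ℂ, Fin n → ℂ) 𝓘(ℂ, Fin n → ℂ) F z : (Fin n → ℂ) →L[ℂ] (Fin n → ℂ)) ≠ 0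

end

noncomputable section

/-! ### Common zeros of two polynomials in three variables -/

/-! Parametrize the cubic f = 0 by an entire curve V in ℂ³ ∖ {0} and sweep out the complement along
tangent lines. The line at V(t) is spanned by V and V', and on it f(cV + V') = c·A + A'/3, where A
is the Hessian cubic along V: tangency kills the terms in c³ and c² (`cubic_tangent`). Off the
flexes the line therefore meets the curve in one further point only, and its complement in the line
is uniformized by an exponential.

Solving f(αV + V') = exp(g(t) + A(t)s) gives α = (exp(g + As) − A'/3)/A, and (t, s) ↦ αV + V' never
meets the curve. Since A has only simple zeros (`deriv_hessian_ne_zero`), α is entire as soon as exp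
g = A'/3 at these zeros, and such an entire g exists by `exists_entire_interpolation`. Varying s
moves along the tangent line, varying t moves off it wherever A ≠ 0, so the map is nondegenerate.

Explicit formulas need Weierstrass form (`exists_weierstrass_form`), hence a flex: a common zero of
f and its Hessian, supplied by Krull's height theorem. The curve V is obtained without elliptic
functions, as a Poincaré function of the duplication map D: the entire solution of V(2t) = D(V(t))
with initial jet (t, 1, t³). The curve equation and the invariant differential follow because their
defects satisfy a linear doubling equation that forces them to vanish (`eq_zero_of_two_mul_eq`). -/

theorem Ideal.three_le_height_vanishingIdeal_zero :
    3 ≤ (MvPolynomial.vanishingIdeal ℂ {(0 : Fin 3 → ℂ)}).height := by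
  let e (k : ℕ) : MvPolynomial (Fin 3) ℂ →ₐ[ℂ] MvPolynomial (Fin 3) ℂ :=
    MvPolynomial.aeval fun i => if (i : ℕ) < k then 0 else MvPolynomial.X i
  -- Setting the first k variables to zero has prime kernel; k = 0, …, 3 gives a strict chain of
  -- primes of length three.
  let p (k : ℕ) : Ideal (MvPolynomial (Fin 3) ℂ) := RingHom.ker (e k)
  have hp (k : ℕ) : (p k).IsPrime := RingHom.ker_isPrime _
  have hmem (k : ℕ) (i : Fin 3) : MvPolynomial.X i ∈ p k ↔ (i : ℕ) < k := by
    simp [p, e, RingHom.mem_ker, MvPolynomial.X_ne_zero]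
  have hcomp (k : ℕ) : (e (k + 1)).comp (e k) = e (k + 1) := by
    refine MvPolynomial.algHom_ext fun i => ?_
    by_cases h : (i : ℕ) < k
    · have h' : (i : ℕ) < k + 1 := h.trans (Nat.lt_succ_self k)
      simp only [e, AlgHom.comp_apply, MvPolynomial.aeval_X, if_pos h, if_pos h', map_zero]
    · simp [e, h]
  have hle (k : ℕ) : p k ≤ p (k + 1) := fun x hx => by
    have h1 : e k x = 0 := hx
    have h2 := DFunLike.congr_fun (hcomp k) x
    rw [AlgHom.comp_apply, h1, map_zero] at h2
    exact h2.symm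
  have hlt (k : ℕ) (hk : k < 3) : p k < p (k + 1) := by
    refine lt_of_le_of_ne (hle k) fun h => ?_
    have := (hmem (k + 1) ⟨k, hk⟩).2 (Nat.lt_succ_self k)
    rw [← h, hmem] at this
    exact lt_irrefl _ this
  have h3 : p 3 ≤ MvPolynomial.vanishingIdeal ℂ {(0 : Fin 3 → ℂ)} := by
    intro x hx
    rw [MvPolynomial.mem_vanishingIdeal_singleton_iff]
    have h1 : e 3 x = 0 := hx
    have h2 : (MvPolynomial.aeval (0 : Fin 3 → ℂ)).comp (e 3) =
        MvPolynomial.aeval (0 : Fin 3 → ℂ) := by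
      refine MvPolynomial.algHom_ext fun i => ?_
      simp [e]
    rw [← h2, AlgHom.comp_apply, h1, map_zero]
  have hheight (k : ℕ) (hk : k ≤ 3) : (k : ℕ∞) ≤ (p k).height := by
    induction k with
    | zero => simp
    | succ k ih =>
      push_cast
      exact (add_le_add_left (ih (by lia)) 1).trans
        (Ideal.height_add_one_le_of_lt_of_isPrime (hlt k (by lia)))
  exact (hheight 3 le_rfl).trans (Ideal.height_mono h3)

/-- Were the origin the only common zero, the Nullstellensatz would make its ideal a minimal prime
over (f, g). Krull's theorem bounds the height of such a prime by two, but this one has height at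
least three. -/
theorem MvPolynomial.exists_common_zero (f g : MvPolynomial (Fin 3) ℂ)
    (hf : eval 0 f = 0) (hg : eval 0 g = 0) :
    ∃ v : Fin 3 → ℂ, v ≠ 0 ∧ eval v f = 0 ∧ eval v g = 0 := by
  by_contra! hcon
  have hmin : vanishingIdeal ℂ {(0 : Fin 3 → ℂ)} ∈
      (Ideal.span {f, g}).minimalPrimes := by
    refine ⟨⟨inferInstance, ?_⟩, ?_⟩
    · rw [Ideal.span_le]
      rintro x (rfl | rfl)
      · simpa [coe_aeval_eq_eval] using hf
      · simpa [coe_aeval_eq_eval] using hg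
    · rintro q ⟨hq, hle⟩ -
      rw [← IsPrime.vanishingIdeal_zeroLocus (K := ℂ) q]
      refine vanishingIdeal_anti_mono fun x hx => ?_
      by_contra hx0
      refine hcon x hx0 ?_ ?_
      · simpa [coe_aeval_eq_eval] using hx f (hle (Ideal.subset_span (by simp)))
      · simpa [coe_aeval_eq_eval] using hx g (hle (Ideal.subset_span (by simp)))
  have h1 := Ideal.height_le_card_of_mem_minimalPrimes_span (Set.toFinite _) hmin
  have h2 := Set.ncard_insert_le f {g}
  rw [Set.ncard_singleton] at h2
  have h3 := Ideal.three_le_height_vanishingIdeal_zero.trans h1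
  have h4 : 3 ≤ ({f, g} : Set (MvPolynomial (Fin 3) ℂ)).ncard := by exact_mod_cast h3
  lia

/-! ### Cubic forms and symmetric trilinear forms -/

/-- Trilinear forms on `ℂ³`. -/
abbrev Trilin : Type := (Fin 3 → ℂ) →ₗ[ℂ] (Fin 3 → ℂ) →ₗ[ℂ] (Fin 3 → ℂ) →ₗ[ℂ] ℂ

/-- `φ` is symmetric. -/
structure Trilin.IsSymm (φ : Trilin) : Prop where
  swap_left : ∀ u v w, φ u v w = φ v u w
  swap_right : ∀ u v w, φ u v w = φ u w v

/-- `φ` is the polarization of the cubic form `f`. -/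
structure Trilin.IsPolarization (φ : Trilin) (f : MvPolynomial (Fin 3) ℂ) : Prop where
  symm : φ.IsSymm
  eval_eq : ∀ v, MvPolynomial.eval v f = φ v v v
  eval_pderiv : ∀ v i, MvPolynomial.eval v (MvPolynomial.pderiv i f) = 3 * φ v v (Pi.single i 1)

/-- The product of three coordinates as a trilinear form. -/
def Trilin.coord (i j k : Fin 3) : Trilin :=
  (LinearMap.proj i : (Fin 3 → ℂ) →ₗ[ℂ] ℂ).smulRight
    ((LinearMap.proj j : (Fin 3 → ℂ) →ₗ[ℂ] ℂ).smulRight (LinearMap.proj k))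

@[simp] theorem Trilin.coord_apply (i j k : Fin 3) (u v w : Fin 3 → ℂ) :
    Trilin.coord i j k u v w = u i * v j * w k := by
  simp [Trilin.coord, mul_assoc]

theorem Trilin.exists_isPolarization_monomial (c : ℂ) (i j k : Fin 3) :
    ∃ φ : Trilin, φ.IsPolarization
      (MvPolynomial.C c * (MvPolynomial.X i * MvPolynomial.X j * MvPolynomial.X k)) := by
  refine ⟨(c / 6) • (coord i j k + coord i k j + coord j i k + coord j k i + coord k i j +
    coord k j i), ⟨?_, ?_⟩, ?_, ?_⟩
  · intro u v w
    simp only [LinearMap.smul_apply, LinearMap.add_apply, coord_apply, smul_eq_mul]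
    ring
  · intro u v w
    simp only [LinearMap.smul_apply, LinearMap.add_apply, coord_apply, smul_eq_mul]
    ring
  · intro v
    simp only [LinearMap.smul_apply, LinearMap.add_apply, coord_apply, smul_eq_mul,
      map_mul, MvPolynomial.eval_C, MvPolynomial.eval_X]
    ring
  · intro v l
    have hX (m : Fin 3) : MvPolynomial.eval v (MvPolynomial.pderiv l (MvPolynomial.X m)) =
        (Pi.single l 1 : Fin 3 → ℂ) m := by
      rw [MvPolynomial.pderiv_X]
      rcases eq_or_ne m l with rfl | h
      · simp
      · simp [h]
    simp only [LinearMap.smul_apply, LinearMap.add_apply, coord_apply, smul_eq_mul,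
      Derivation.leibniz, MvPolynomial.pderiv_C, map_mul, map_add, MvPolynomial.eval_C,
      MvPolynomial.eval_X, hX, map_zero]
    ring

/-- By linearity it suffices to polarize a product of three coordinates, which is done by averaging
over its six orderings. -/
theorem Trilin.exists_isPolarization {f : MvPolynomial (Fin 3) ℂ} (hf : f.IsHomogeneous 3) :
    ∃ φ : Trilin, φ.IsPolarization f := by
  rw [f.as_sum]
  refine Finset.sum_induction _ (fun g => ∃ φ : Trilin, φ.IsPolarization g) ?_ ?_ ?_
  · rintro g h ⟨φ, hφ⟩ ⟨ψ, hψ⟩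
    refine ⟨φ + ψ, ⟨?_, ?_⟩, ?_, ?_⟩
    · intro u v w
      simp [hφ.symm.swap_left u v w, hψ.symm.swap_left u v w]
    · intro u v w
      simp [hφ.symm.swap_right u v w, hψ.symm.swap_right u v w]
    · intro v
      simp [hφ.eval_eq, hψ.eval_eq]
    · intro v i
      simp [hφ.eval_pderiv, hψ.eval_pderiv, mul_add]
  · exact ⟨0, ⟨by simp, by simp⟩, by simp, by simp⟩
  · intro d hd
    have hdeg : (Finsupp.toMultiset d).card = 3 := by
      rw [Finsupp.card_toMultiset]
      have := hf (MvPolynomial.mem_support_iff.1 hd)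
      rw [Finsupp.weight_apply] at this
      simpa [Finsupp.sum] using this
    obtain ⟨i, j, k, h⟩ := Multiset.card_eq_three.1 hdeg
    have hd' : d = Finsupp.single i 1 + Finsupp.single j 1 + Finsupp.single k 1 := by
      apply Multiset.toFinsupp.symm.injective
      change Finsupp.toMultiset d = Finsupp.toMultiset _
      rw [h]
      simp [Finsupp.toMultiset_single]
    have : MvPolynomial.monomial d (f.coeff d) = MvPolynomial.C (f.coeff d) *
        (MvPolynomial.X i * MvPolynomial.X j * MvPolynomial.X k) := by
      generalize f.coeff d = c
      rw [hd', MvPolynomial.X, MvPolynomial.X, MvPolynomial.X, MvPolynomial.monomial_mul,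
        MvPolynomial.monomial_mul, MvPolynomial.C_mul_monomial]
      simp
    rw [this]
    exact Trilin.exists_isPolarization_monomial _ _ _ _

/-! ### The Weierstrass form of a smooth plane cubic -/

/-- The Weierstrass cubic form `Y²Z - X³ - aXZ² - bZ³`. -/
def weierstrassCubic (a b x y z : ℂ) : ℂ := y ^ 2 * z - x ^ 3 - a * x * z ^ 2 - b * z ^ 3

namespace Trilin

variable {φ : Trilin}

/-- The determinant of the matrix of φ v is the Hessian of the cubic up to a factor; v is a common
zero of it and the cubic, and w is a null vector of φ v. -/
theorem IsSymm.exists_flex (hφ : φ.IsSymm) {f : MvPolynomial (Fin 3) ℂ}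
    (hf : ∀ v, MvPolynomial.eval v f = φ v v v) :
    ∃ v w : Fin 3 → ℂ, v ≠ 0 ∧ w ≠ 0 ∧ φ v v v = 0 ∧ ∀ u, φ v w u = 0 := by
  let M : Matrix (Fin 3) (Fin 3) (MvPolynomial (Fin 3) ℂ) := Matrix.of fun i j =>
    ∑ l, MvPolynomial.C (φ (Pi.single l 1) (Pi.single i 1) (Pi.single j 1)) * MvPolynomial.X l
  have hM (v : Fin 3 → ℂ) : MvPolynomial.eval v M.det =
      (Matrix.of fun i j => φ v (Pi.single i 1) (Pi.single j 1)).det := by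
    rw [RingHom.map_det]
    congr 1
    ext i j
    have h : v = ∑ l, v l • (Pi.single l 1 : Fin 3 → ℂ) := (pi_eq_sum_univ' v)
    conv_rhs => rw [h]
    simp [M, map_sum, LinearMap.sum_apply, mul_comm]
  obtain ⟨v, hv, hv1, hv2⟩ := MvPolynomial.exists_common_zero f M.det (by rw [hf]; simp)
    (by rw [hM]; simp [Matrix.det_fin_three])
  rw [hM] at hv2
  obtain ⟨w, hw, hw2⟩ := Matrix.exists_mulVec_eq_zero_iff.2 hv2
  refine ⟨v, w, hv, hw, by rw [← hf, hv1], fun u => ?_⟩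
  have key (i : Fin 3) : φ v w (Pi.single i 1) = 0 := by
    have h1 := congrFun hw2 i
    rw [hφ.swap_right]
    have h : w = ∑ l, w l • (Pi.single l 1 : Fin 3 → ℂ) := (pi_eq_sum_univ' w)
    conv_lhs => rw [h]
    simpa [Matrix.mulVec, dotProduct, map_sum, mul_comm] using h1
  have h : u = ∑ l, u l • (Pi.single l 1 : Fin 3 → ℂ) := (pi_eq_sum_univ' u)
  rw [h]
  simp [map_sum, key]

theorem IsSymm.apply_comb (hφ : φ.IsSymm) (p q r : Fin 3 → ℂ) (x y z : ℂ) :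
    φ (x • p + y • q + z • r) (x • p + y • q + z • r) (x • p + y • q + z • r) =
      x ^ 3 * φ p p p + y ^ 3 * φ q q q + z ^ 3 * φ r r r + 3 * x ^ 2 * y * φ p p q +
      3 * x ^ 2 * z * φ p p r + 3 * x * y ^ 2 * φ q q p + 3 * y ^ 2 * z * φ q q r +
      3 * x * z ^ 2 * φ r r p + 3 * y * z ^ 2 * φ r r q + 6 * x * y * z * φ q p r := by
  have e1 (u v : Fin 3 → ℂ) : φ u v u = φ u u v := hφ.swap_right u v u
  have e2 (u v : Fin 3 → ℂ) : φ v u u = φ u u v := by rw [hφ.swap_left, e1]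
  have e3 : φ p q r = φ q p r := hφ.swap_left _ _ _
  have e4 : φ p r q = φ q p r := by rw [hφ.swap_right, e3]
  have e5 : φ q r p = φ q p r := by rw [hφ.swap_right]
  have e6 : φ r p q = φ q p r := by rw [hφ.swap_left, e4]
  have e7 : φ r q p = φ q p r := by rw [hφ.swap_left, e5]
  simp only [map_add, map_smul, LinearMap.add_apply, LinearMap.smul_apply, smul_eq_mul]
  rw [e1 p q, e1 p r, e1 q p, e1 q r, e1 r p, e1 r q, e2 p q, e2 p r, e2 q p, e2 q r, e2 r p,
    e2 r q, e3, e4, e5, e6, e7]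
  ring

/-- Recovers the gradient at s from values of the cubic form alone. -/
theorem IsSymm.six_mul_apply (hφ : φ.IsSymm) (s n : Fin 3 → ℂ) :
    6 * φ s s n = φ (s + n) (s + n) (s + n) - φ (s - n) (s - n) (s - n) - 2 * φ n n n := by
  have h1 := hφ.apply_comb s n 0 1 1 0
  have h2 := hφ.apply_comb s n 0 1 (-1) 0
  simp only [one_smul, zero_smul, add_zero, neg_smul, ← sub_eq_add_neg] at h1 h2
  rw [h1, h2]
  ring

theorem eq_zero_of_basis {p q r : Fin 3 → ℂ}
    (hli : ∀ x y z : ℂ, x • p + y • q + z • r = 0 → x = 0 ∧ y = 0 ∧ z = 0)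
    (l : (Fin 3 → ℂ) →ₗ[ℂ] ℂ) (hp : l p = 0) (hq : l q = 0) (hr : l r = 0) : l = 0 := by
  have hli' : LinearIndependent ℂ ![p, q, r] := by
    rw [Fintype.linearIndependent_iff]
    intro g hg
    have := hli (g 0) (g 1) (g 2) (by simpa [Fin.sum_univ_three] using hg)
    intro i
    fin_cases i
    exacts [this.1, this.2.1, this.2.2]
  let B := basisOfLinearIndependentOfCardEqFinrank hli' (by simp)
  refine B.ext fun i => ?_
  fin_cases i <;> simp [B, hp, hq, hr]

/-- A smooth plane cubic has Weierstrass form in suitable coordinates. -/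
theorem IsSymm.exists_weierstrass (hφ : φ.IsSymm) {f : MvPolynomial (Fin 3) ℂ}
    (hf : ∀ v, MvPolynomial.eval v f = φ v v v)
    (hsm : ∀ v, v ≠ 0 → φ v v ≠ 0) :
    ∃ (p q r : Fin 3 → ℂ) (a b c : ℂ), c ≠ 0 ∧
      (∀ x y z : ℂ, x • p + y • q + z • r = 0 → x = 0 ∧ y = 0 ∧ z = 0) ∧
      (∀ x y z : ℂ, φ (x • p + y • q + z • r) (x • p + y • q + z • r) (x • p + y • q + z • r) =
        c * weierstrassCubic a b x y z) ∧
      ∀ x : ℂ, x ^ 3 + a * x + b = 0 → 3 * x ^ 2 + a ≠ 0 := by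
  obtain ⟨v, w, hv, hw, hvvv, hvw⟩ := hφ.exists_flex hf
  have hvv := hsm v hv
  obtain ⟨u, hu⟩ : ∃ u, φ v v u ≠ 0 := by
    by_contra! h
    exact hvv (LinearMap.ext h)
  have hvvw : φ v v w = 0 := by rw [hφ.swap_right]; exact hvw v
  have hwwv : φ w w v = 0 := by rw [hφ.swap_right, hφ.swap_left]; exact hvw w
  have hli : ∀ x y z : ℂ, x • w + y • v + z • u = 0 → x = 0 ∧ y = 0 ∧ z = 0 := by
    intro x y z h
    have hz : z = 0 := by
      have := congrArg (φ v v) h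
      simpa [hvvw, hvvv, hu] using this
    subst hz
    have hy : y = 0 := by
      by_contra hy
      have := congrArg (fun s => φ v s u) h
      simp only [map_add, map_smul, zero_smul, map_zero, LinearMap.add_apply,
        LinearMap.smul_apply, LinearMap.zero_apply, hvw, smul_eq_mul, mul_zero, zero_add,
        add_zero, mul_eq_zero] at this
      exact this.elim hy hu
    subst hy
    refine ⟨?_, rfl, rfl⟩
    simpa [hw] using h
  have hwww : φ w w w ≠ 0 := by
    intro hwww
    -- If φ w w w = 0, this α makes αv + w a singular point.
    obtain ⟨α, hα⟩ := IsAlgClosed.exists_eq_mul_self (-(φ w w u) / φ v v u)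
    have hs : α • v + w ≠ 0 := by
      intro h
      have := hli 1 α 0 (by rw [← h]; simp [add_comm])
      exact one_ne_zero this.1
    refine hsm _ hs (eq_zero_of_basis hli _ ?_ ?_ ?_)
    · simp [hvvw, hvw, hwww, hφ.swap_left w v w]
    · simp [hvvv, hvw, hwwv, hφ.swap_left w v v]
    · have : α * α * φ v v u = -(φ w w u) := by rw [← hα]; field_simp
      simp only [map_add, map_smul, LinearMap.add_apply, LinearMap.smul_apply, smul_eq_mul, hvw,
        hφ.swap_left w v u]
      linear_combination this
  -- In the basis w, v, u the terms x²y, xy², xyz and y³ are already absent. The factor l makes the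
  -- coefficients of x³ and y²z opposite; below, β and γ complete the square and the cube, removing
  -- yz² and x²z.
  obtain ⟨l, hl⟩ := IsAlgClosed.exists_pow_nat_eq (-(3 * φ v v u) / φ w w w) (n := 3) (by simp)
  have hl' : l ^ 3 * φ w w w = -(3 * φ v v u) := by rw [hl]; field_simp
  have hl0 : l ≠ 0 := by
    rintro rfl
    simp [hu] at hl'
  set c := φ w w w with hc
  set e := 3 * φ v v u with he
  have he0 : e ≠ 0 := by simp [he, hu]
  set β := -(3 * φ u u v) / (2 * e) with hβ
  set γ := -(3 * φ w w u) / (3 * c) with hγ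
  have hβ' : 2 * e * β = -(3 * φ u u v) := by rw [hβ]; field_simp
  have hγ' : 3 * c * γ = -(3 * φ w w u) := by rw [hγ]; field_simp
  set a := -l * (3 * c * γ ^ 2 + 2 * (3 * φ w w u) * γ + 3 * φ u u w) / e with ha
  set b := -(c * γ ^ 3 + e * β ^ 2 + 3 * φ w w u * γ ^ 2 + 3 * φ u u w * γ +
    3 * φ u u v * β + φ u u u) / e with hb
  have ha' : e * a = -l * (3 * c * γ ^ 2 + 2 * (3 * φ w w u) * γ + 3 * φ u u w) := by
    rw [ha]; field_simp
  have hb' : e * b = -(c * γ ^ 3 + e * β ^ 2 + 3 * φ w w u * γ ^ 2 + 3 * φ u u w * γ +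
    3 * φ u u v * β + φ u u u) := by rw [hb]; field_simp
  clear_value a b β γ
  clear_value c e
  have hcoord (x y z : ℂ) : x • (l • w) + y • v + z • (u + β • v + γ • w) =
      (l * x + γ * z) • w + (y + β * z) • v + z • u := by module
  have hli2 : ∀ x y z : ℂ, x • (l • w) + y • v + z • (u + β • v + γ • w) = 0 →
      x = 0 ∧ y = 0 ∧ z = 0 := by
    intro x y z h
    rw [hcoord] at h
    obtain ⟨h1, h2, rfl⟩ := hli _ _ _ h
    simpa [hl0] using And.intro h1 h2
  have hW : ∀ x y z : ℂ, φ (x • (l • w) + y • v + z • (u + β • v + γ • w))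
      (x • (l • w) + y • v + z • (u + β • v + γ • w))
      (x • (l • w) + y • v + z • (u + β • v + γ • w)) = e * weierstrassCubic a b x y z := by
    intro x y z
    rw [hcoord, hφ.apply_comb, hvvv, hvvw, hwwv, hvw u, weierstrassCubic]
    linear_combination x ^ 3 * hl' + l ^ 2 * x ^ 2 * z * hγ' + x * z ^ 2 * ha' + z ^ 3 * hb' +
      y * z ^ 2 * hβ' - z * (y + β * z) ^ 2 * he -
      (l * x + γ * z) ^ 3 * hc
  refine ⟨l • w, v, u + β • v + γ • w, a, b, e, he0, hli2, hW, fun x hx hx' => ?_⟩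
  -- A double root x would make the point (x : 0 : 1) singular.
  set s := x • (l • w) + (0 : ℂ) • v + (1 : ℂ) • (u + β • v + γ • w) with hs
  have hs0 : s ≠ 0 := fun h => one_ne_zero (hli2 _ _ _ h).2.2
  have hdir (i j k : ℂ) : 6 * φ s s (i • (l • w) + j • v + k • (u + β • v + γ • w)) =
      e * weierstrassCubic a b (x + i) j (1 + k) - e * weierstrassCubic a b (x - i) (-j) (1 - k) -
      2 * (e * weierstrassCubic a b i j k) := by
    rw [hφ.six_mul_apply, ← hW, ← hW, ← hW]
    have h1 : s + (i • (l • w) + j • v + k • (u + β • v + γ • w)) =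
      (x + i) • (l • w) + j • v + (1 + k) • (u + β • v + γ • w) := by rw [hs]; module
    have h2 : s - (i • (l • w) + j • v + k • (u + β • v + γ • w)) =
      (x - i) • (l • w) + (-j) • v + (1 - k) • (u + β • v + γ • w) := by rw [hs]; module
    rw [h1, h2]
  refine hsm s hs0 (eq_zero_of_basis hli2 _ ?_ ?_ ?_)
  · have := hdir 1 0 0
    simp only [one_smul, zero_smul, add_zero, weierstrassCubic] at this
    linear_combination this / 6 - e / 3 * hx'
  · have := hdir 0 1 0
    simp only [one_smul, zero_smul, add_zero, zero_add, weierstrassCubic] at this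
    linear_combination this / 6
  · have := hdir 0 0 1
    simp only [one_smul, zero_smul, add_zero, zero_add, weierstrassCubic] at this
    linear_combination this / 6 - e / 3 * (3 * hx - x * hx')

end Trilin

theorem exists_weierstrass_form {f : MvPolynomial (Fin 3) ℂ} (hf : f.IsHomogeneous 3)
    (hsm : ∀ v : Fin 3 → ℂ, v ≠ 0 → MvPolynomial.eval v f = 0 →
      ∃ i, MvPolynomial.eval v (MvPolynomial.pderiv i f) ≠ 0) :
    ∃ (p q r : Fin 3 → ℂ) (a b c : ℂ), c ≠ 0 ∧
      (∀ x y z : ℂ, x • p + y • q + z • r = 0 → x = 0 ∧ y = 0 ∧ z = 0) ∧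
      (∀ x y z : ℂ, MvPolynomial.eval (x • p + y • q + z • r) f =
        c * weierstrassCubic a b x y z) ∧
      ∀ x : ℂ, x ^ 3 + a * x + b = 0 → 3 * x ^ 2 + a ≠ 0 := by
  obtain ⟨φ, hφ⟩ := Trilin.exists_isPolarization hf
  simp only [hφ.eval_eq]
  refine hφ.symm.exists_weierstrass hφ.eval_eq fun v hv h => ?_
  obtain ⟨i, hi⟩ := hsm v hv (by rw [hφ.eval_eq, h, LinearMap.zero_apply])
  rw [hφ.eval_pderiv, h] at hi
  simp at hi

/-! ### Poincaré functions -/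

-- Every t lies in the given disc after enough halvings; this spreads local facts about solutions of
-- a doubling equation to all of ℂ.
open Filter Topology in
theorem forall_of_forall_two_mul {p : ℂ → Prop} {r : ℝ} (hr : 0 < r)
    (h0 : ∀ t, ‖t‖ < r → p t) (h2 : ∀ t, p t → p (2 * t)) (t : ℂ) : p t := by
  have hn (n : ℕ) : ∀ t : ℂ, p (t / 2 ^ n) → p t := by
    induction n with
    | zero => simp
    | succ n ih =>
      intro t ht
      refine ih t ?_
      have := h2 _ ht
      rwa [pow_succ, ← div_div, mul_div_cancel₀ _ two_ne_zero] at this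
  have hlim : Tendsto (fun n : ℕ => ‖t‖ * (1 / 2 : ℝ) ^ n) atTop (𝓝 (‖t‖ * 0)) :=
    (tendsto_pow_atTop_nhds_zero_of_lt_one (by norm_num) (by norm_num)).const_mul _
  rw [mul_zero] at hlim
  obtain ⟨n, hn'⟩ := (hlim.eventually_lt_const hr).exists
  refine hn n t (h0 _ ?_)
  rw [norm_div, norm_pow, Complex.norm_two, div_eq_mul_one_div, ← one_div_pow]
  exact hn'

open Filter Topology in
/-- A function `e` with `e (2t) = G t * e t` that vanishes to fourth order at `0` is zero if
`‖G 0‖ < 9`. -/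
theorem eq_zero_of_two_mul_eq {e G : ℂ → ℂ} (he : e =O[𝓝 0] fun t => t ^ 4)
    (hG : ContinuousAt G 0) (hG0 : ‖G 0‖ < 9) (h : ∀ t, e (2 * t) = G t * e t) (t : ℂ) :
    e t = 0 := by
  obtain ⟨C, hC⟩ := he.bound
  have hG' : ∀ᶠ t in 𝓝 (0 : ℂ), ‖G t‖ < 9 := hG.norm.eventually_lt_const hG0
  obtain ⟨r, hr, hball⟩ := Metric.eventually_nhds_iff.1 (hC.and hG')
  simp only [dist_zero_right] at hball
  refine forall_of_forall_two_mul (p := fun t => e t = 0) hr ?_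
    (fun t ht => by rw [h, ht, mul_zero]) t
  intro t ht
  -- One use of the equation at t/2 costs a factor 9, while the fourth-order bound gains 2⁻⁴.
  have hn (n : ℕ) : ∀ t : ℂ, ‖t‖ < r → ‖e t‖ ≤ C * ‖t‖ ^ 4 * (9 / 16) ^ n := by
    induction n with
    | zero =>
      intro t ht
      simpa using (hball ht).1
    | succ n ih =>
      intro t ht
      have ht2 : ‖t / 2‖ < r := by
        rw [norm_div, Complex.norm_two]
        linarith [norm_nonneg t]
      have h1 := ih (t / 2) ht2
      have h2 := h (t / 2)
      rw [mul_div_cancel₀ _ two_ne_zero] at h2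
      rw [h2, norm_mul]
      rw [norm_div, Complex.norm_two] at h1
      calc ‖G (t / 2)‖ * ‖e (t / 2)‖ ≤ 9 * (C * (‖t‖ / 2) ^ 4 * (9 / 16) ^ n) :=
            mul_le_mul (hball ht2).2.le h1 (norm_nonneg _) (by norm_num)
        _ = _ := by ring
  have hlim : Tendsto (fun n : ℕ => C * ‖t‖ ^ 4 * (9 / 16 : ℝ) ^ n) atTop
      (𝓝 (C * ‖t‖ ^ 4 * 0)) :=
    (tendsto_pow_atTop_nhds_zero_of_lt_one (by norm_num) (by norm_num)).const_mul _
  rw [mul_zero] at hlim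
  exact norm_le_zero_iff.1 (ge_of_tendsto' hlim fun n => hn n t ht)

open Filter Topology in
/-- If the germ `i` solves `P (i (t / 2)) = i t` up to fourth order at `0` and `P` expands distances
near `i 0` at most by the factor `9 < 2 ^ 4`, then there is an entire solution that agrees with `i`
up to fourth order. -/
theorem exists_entire_two_mul_eq {E : Type*} [NormedAddCommGroup E] [NormedSpace ℂ E]
    [CompleteSpace E] {P : E → E} (hP : Differentiable ℂ P) {i : ℂ → E} (hi : Differentiable ℂ i)
    {δ : ℝ} (hδ : 0 < δ)
    (hLip : ∀ v w, ‖v - i 0‖ < δ → ‖w - i 0‖ < δ → ‖P v - P w‖ ≤ 9 * ‖v - w‖)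
    {K : ℝ} (hK : ∀ t : ℂ, ‖t‖ ≤ 1 → ‖P (i (t / 2)) - i t‖ ≤ K * ‖t‖ ^ 4) :
    ∃ v : ℂ → E, Differentiable ℂ v ∧ (∀ t, v (2 * t) = P (v t)) ∧
      (fun t => v t - i t) =O[𝓝 0] fun t => t ^ 4 := by
  -- The solution is the limit of these iterates. Successive differences shrink by 9/16: a factor 9
  -- from the Lipschitz bound against 2⁻⁴ from halving t.
  let u (n : ℕ) (t : ℂ) : E := P^[n] (i (t / 2 ^ n))
  have hK0 : 0 ≤ K := by
    have := (norm_nonneg _).trans (hK 1 (by simp))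
    simpa using this
  have hu0 (t : ℂ) : u 0 t = i t := by simp [u]
  have husucc (n : ℕ) (t : ℂ) : u (n + 1) t = P (u n (t / 2)) := by
    simp only [u, Function.iterate_succ_apply', div_div, pow_succ']
  have hudiff (n : ℕ) : Differentiable ℂ (u n) := by
    induction n with
    | zero =>
      have : u 0 = i := funext hu0
      rwa [this]
    | succ n ih =>
      have : u (n + 1) = fun t => P (u n (t / 2)) := funext (husucc n)
      rw [this]
      exact hP.comp (ih.comp (differentiable_id.div_const 2))
  have hcont : ∀ᶠ t in 𝓝 (0 : ℂ), ‖i t - i 0‖ < δ / 2 := by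
    have h1 : Tendsto (fun t => ‖i t - i 0‖) (𝓝 0) (𝓝 ‖i 0 - i 0‖) :=
      ((hi.continuous.tendsto 0).sub_const _).norm
    rw [sub_self, norm_zero] at h1
    exact h1.eventually_lt_const (by positivity)
  have hsmall : ∀ᶠ t in 𝓝 (0 : ℂ), 3 * K * ‖t‖ ^ 4 < δ / 2 := by
    have h1 : Tendsto (fun t : ℂ => 3 * K * ‖t‖ ^ 4) (𝓝 0) (𝓝 (3 * K * ‖(0 : ℂ)‖ ^ 4)) :=
      Continuous.tendsto (by fun_prop) 0
    rw [norm_zero, zero_pow (by norm_num), mul_zero] at h1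
    exact h1.eventually_lt_const (by positivity)
  have hone : ∀ᶠ t in 𝓝 (0 : ℂ), ‖t‖ < 1 := by
    filter_upwards [Metric.ball_mem_nhds (0 : ℂ) one_pos] with t ht
    simpa using ht
  obtain ⟨r, hr, hball⟩ := Metric.eventually_nhds_iff.1 (hcont.and (hsmall.and hone))
  simp only [dist_zero_right] at hball
  have half {t : ℂ} (ht : ‖t‖ < r) : ‖t / 2‖ < r := by
    rw [norm_div, Complex.norm_two]
    linarith [norm_nonneg t]
  have key (n : ℕ) : ∀ t : ℂ, ‖t‖ < r →
      ‖u n t - i t‖ ≤ K * ‖t‖ ^ 4 * (16 / 7 * (1 - (9 / 16) ^ n)) ∧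
      ‖u (n + 1) t - u n t‖ ≤ K * ‖t‖ ^ 4 * (9 / 16) ^ n := by
    -- The geometric sum is at most 16/7 ≤ 3, and r was chosen with 3K‖t‖⁴ < δ/2, so the iterates
    -- stay where `hLip` applies.
    have near {n : ℕ} {t : ℂ} (ht : ‖t‖ < r)
        (h : ‖u n t - i t‖ ≤ K * ‖t‖ ^ 4 * (16 / 7 * (1 - (9 / 16) ^ n))) :
        ‖u n t - i 0‖ < δ := by
      have h1 : ‖u n t - i 0‖ ≤ ‖u n t - i t‖ + ‖i t - i 0‖ := norm_sub_le_norm_sub_add_norm_sub _ _ _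
      have h2 : K * ‖t‖ ^ 4 * (16 / 7 * (1 - (9 / 16) ^ n)) ≤ K * ‖t‖ ^ 4 * 3 := by
        gcongr
        have : (0 : ℝ) ≤ (9 / 16) ^ n := by positivity
        linarith
      linarith [(hball ht).1, (hball ht).2.1]
    induction n with
    | zero =>
      intro t ht
      rw [husucc, hu0, hu0]
      simpa using hK t (hball ht).2.2.le
    | succ n ih =>
      have hfst : ∀ t : ℂ, ‖t‖ < r →
          ‖u (n + 1) t - i t‖ ≤ K * ‖t‖ ^ 4 * (16 / 7 * (1 - (9 / 16) ^ (n + 1))) := by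
        intro t ht
        calc ‖u (n + 1) t - i t‖ ≤ ‖u (n + 1) t - u n t‖ + ‖u n t - i t‖ :=
              norm_sub_le_norm_sub_add_norm_sub _ _ _
          _ ≤ K * ‖t‖ ^ 4 * (9 / 16) ^ n + K * ‖t‖ ^ 4 * (16 / 7 * (1 - (9 / 16) ^ n)) :=
              add_le_add (ih t ht).2 (ih t ht).1
          _ = _ := by ring
      intro t ht
      refine ⟨hfst t ht, ?_⟩
      rw [husucc (n + 1) t, husucc n t]
      calc _ ≤ 9 * ‖u (n + 1) (t / 2) - u n (t / 2)‖ :=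
            hLip _ _ (near (half ht) (hfst _ (half ht))) (near (half ht) (ih _ (half ht)).1)
        _ ≤ 9 * (K * ‖t / 2‖ ^ 4 * (9 / 16) ^ n) := by
            gcongr
            exact (ih _ (half ht)).2
        _ = _ := by
            rw [norm_div, Complex.norm_two]
            ring
  have hlim : ∀ t : ℂ, ∃ x, Tendsto (fun n => u n t) atTop (𝓝 x) := by
    refine forall_of_forall_two_mul hr (fun t ht => ?_) ?_
    · refine cauchySeq_tendsto_of_complete
        (cauchySeq_of_le_geometric (9 / 16) (K * ‖t‖ ^ 4) (by norm_num) fun n => ?_)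
      rw [dist_comm, dist_eq_norm]
      exact (key n t ht).2
    · rintro t ⟨x, hx⟩
      refine ⟨P x, ?_⟩
      rw [← tendsto_add_atTop_iff_nat 1]
      simp only [husucc, mul_div_cancel_left₀ _ (two_ne_zero' ℂ)]
      exact (hP.continuous.tendsto x).comp hx
  choose v hv using hlim
  have hv2 (t : ℂ) : v (2 * t) = P (v t) := by
    have h1 := (tendsto_add_atTop_iff_nat 1).2 (hv (2 * t))
    simp only [husucc, mul_div_cancel_left₀ _ (two_ne_zero' ℂ)] at h1
    exact tendsto_nhds_unique h1 ((hP.continuous.tendsto _).comp (hv t))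
  have hunif : TendstoLocallyUniformlyOn u v atTop (Metric.ball 0 r) := by
    refine TendstoUniformlyOn.tendstoLocallyUniformlyOn ?_
    rw [Metric.tendstoUniformlyOn_iff]
    intro ε hε
    have h1 : Tendsto (fun n : ℕ => K * (9 / 16 : ℝ) ^ n / (1 - 9 / 16)) atTop
        (𝓝 (K * 0 / (1 - 9 / 16))) :=
      ((tendsto_pow_atTop_nhds_zero_of_lt_one (by norm_num) (by norm_num)).const_mul _).div_const _
    rw [mul_zero, zero_div] at h1
    filter_upwards [h1.eventually_lt_const hε] with n hn t ht
    rw [mem_ball_zero_iff] at ht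
    rw [dist_comm]
    refine lt_of_le_of_lt ?_ hn
    refine dist_le_of_le_geometric_of_tendsto (9 / 16) K (by norm_num) (fun n => ?_) (hv t) n
    rw [dist_comm, dist_eq_norm]
    refine (key n t ht).2.trans ?_
    have h4 : ‖t‖ ^ 4 ≤ 1 := pow_le_one₀ (norm_nonneg _) (hball ht).2.2.le
    have : K * ‖t‖ ^ 4 ≤ K * 1 := by gcongr
    rw [mul_one] at this
    gcongr
  have hdiff0 : DifferentiableOn ℂ v (Metric.ball 0 r) :=
    hunif.differentiableOn (Eventually.of_forall fun n => (hudiff n).differentiableOn)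
      Metric.isOpen_ball
  refine ⟨v, ?_, hv2, ?_⟩
  · refine forall_of_forall_two_mul hr (fun t ht => ?_) fun t ht => ?_
    · exact hdiff0.differentiableAt (Metric.isOpen_ball.mem_nhds (by simpa using ht))
    · have h1 : v = fun s => P (v (s / 2)) := by
        funext s
        rw [← hv2, mul_div_cancel₀ _ (two_ne_zero' ℂ)]
      rw [h1]
      refine (hP _).comp _ (DifferentiableAt.comp (g := v) _ ?_ (by fun_prop))
      rwa [mul_div_cancel_left₀ _ (two_ne_zero' ℂ)]
  · refine Asymptotics.IsBigO.of_bound (3 * K) ?_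
    filter_upwards [Metric.ball_mem_nhds (0 : ℂ) hr] with t ht
    rw [mem_ball_zero_iff] at ht
    rw [norm_pow]
    refine le_of_tendsto ((hv t).sub_const _).norm (Eventually.of_forall fun n => ?_)
    refine (key n t ht).1.trans ?_
    have : (0 : ℝ) ≤ (9 / 16) ^ n := by positivity
    have h5 : 16 / 7 * (1 - (9 / 16 : ℝ) ^ n) ≤ 3 := by linarith
    calc _ ≤ K * ‖t‖ ^ 4 * 3 := by gcongr
      _ = _ := by ring

/-! ### The duplication map of a Weierstrass cubic -/

/-- The duplication map of the curve `Y²Z = X³ + aXZ² + bZ³` in homogeneous coordinates. -/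
def duplication (a b : ℂ) (v : ℂ × ℂ × ℂ) : ℂ × ℂ × ℂ :=
  (2 * v.2.1 * (v.1 * v.2.1 ^ 2 - 3 * a * v.1 ^ 2 * v.2.2 - 9 * b * v.1 * v.2.2 ^ 2 +
      a ^ 2 * v.2.2 ^ 3),
    (v.2.1 ^ 2 - a * v.1 * v.2.2 - b * v.2.2 ^ 2) ^ 2 + 5 * a * v.1 ^ 4 +
      20 * b * v.1 ^ 3 * v.2.2 - 5 * a ^ 2 * v.1 ^ 2 * v.2.2 ^ 2 - 4 * a * b * v.1 * v.2.2 ^ 3 -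
      (8 * b ^ 2 + a ^ 3) * v.2.2 ^ 4,
    8 * v.2.1 ^ 3 * v.2.2)

theorem differentiable_duplication (a b : ℂ) : Differentiable ℂ (duplication a b) := by
  unfold duplication
  fun_prop

theorem exists_lipschitz_duplication (a b : ℂ) : ∃ δ > 0, ∀ v w : ℂ × ℂ × ℂ,
    ‖v - (0, 1, 0)‖ < δ → ‖w - (0, 1, 0)‖ < δ →
      ‖duplication a b v - duplication a b w‖ ≤ 9 * ‖v - w‖ := by
  let px : (ℂ × ℂ × ℂ) →L[ℂ] ℂ := ContinuousLinearMap.fst ℂ ℂ (ℂ × ℂ)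
  let py : (ℂ × ℂ × ℂ) →L[ℂ] ℂ :=
    (ContinuousLinearMap.fst ℂ ℂ ℂ).comp (ContinuousLinearMap.snd ℂ ℂ (ℂ × ℂ))
  let pz : (ℂ × ℂ × ℂ) →L[ℂ] ℂ :=
    (ContinuousLinearMap.snd ℂ ℂ ℂ).comp (ContinuousLinearMap.snd ℂ ℂ (ℂ × ℂ))
  have hx : HasStrictFDerivAt (fun v : ℂ × ℂ × ℂ => v.1) px (0, 1, 0) := px.hasStrictFDerivAt
  have hy : HasStrictFDerivAt (fun v : ℂ × ℂ × ℂ => v.2.1) py (0, 1, 0) := py.hasStrictFDerivAt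
  have hz : HasStrictFDerivAt (fun v : ℂ × ℂ × ℂ => v.2.2) pz (0, 1, 0) := pz.hasStrictFDerivAt
  have h1 := (hy.const_mul 2).mul ((((hx.mul (hy.pow 2)).sub
    (((hx.pow 2).const_mul (3 * a)).mul hz)).sub ((hx.const_mul (9 * b)).mul (hz.pow 2))).add
      ((hz.pow 3).const_mul (a ^ 2)))
  have h2 := ((((((((hy.pow 2).sub ((hx.const_mul a).mul hz)).sub
    ((hz.pow 2).const_mul b)).pow 2).add ((hx.pow 4).const_mul (5 * a))).add
    (((hx.pow 3).const_mul (20 * b)).mul hz)).sub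
    (((hx.pow 2).const_mul (5 * a ^ 2)).mul (hz.pow 2))).sub
    ((hx.const_mul (4 * a * b)).mul (hz.pow 3))).sub
    ((hz.pow 4).const_mul (8 * b ^ 2 + a ^ 3))
  have h3 := ((hy.pow 3).const_mul 8).mul hz
  -- The eigenvalues 2, 4, 8 lie below 9 < 2⁴, so only the jet of order three of a Poincaré function
  -- has to be prescribed.
  let D : (ℂ × ℂ × ℂ) →L[ℂ] ℂ × ℂ × ℂ := ((2 : ℂ) • px).prod (((4 : ℂ) • py).prod ((8 : ℂ) • pz))
  have hD : HasStrictFDerivAt (duplication a b) D (0, 1, 0) := by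
    refine (h1.prodMk (h2.prodMk h3)).congr_fderiv ?_
    refine ContinuousLinearMap.ext fun v => ?_
    simp [D, px, py, pz]
    ring
  have hnorm : ‖D‖ ≤ 8 := by
    refine ContinuousLinearMap.opNorm_le_bound _ (by norm_num) fun v => ?_
    have e1 : ‖v.1‖ ≤ ‖v‖ := norm_fst_le v
    have e2 : ‖v.2.1‖ ≤ ‖v‖ := (norm_fst_le v.2).trans (norm_snd_le v)
    have e3 : ‖v.2.2‖ ≤ ‖v‖ := (norm_snd_le v.2).trans (norm_snd_le v)
    have := norm_nonneg v
    simp only [D, px, py, pz, ContinuousLinearMap.prod_apply, norm_prod_le_iff]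
    refine ⟨?_, ?_, ?_⟩ <;> simp only [_root_.smul_apply, ContinuousLinearMap.comp_apply,
      ContinuousLinearMap.coe_fst', ContinuousLinearMap.coe_snd', norm_smul] <;>
      norm_num <;> linarith
  obtain ⟨s, hs, hlip⟩ := hD.exists_lipschitzOnWith_of_nnnorm_lt 9 (by
    rw [← NNReal.coe_lt_coe, coe_nnnorm]
    exact hnorm.trans_lt (by norm_num))
  obtain ⟨δ, hδ, hsub⟩ := Metric.mem_nhds_iff.1 hs
  refine ⟨δ, hδ, fun v w hv hw => ?_⟩
  exact (lipschitzOnWith_iff_norm_sub_le.1 hlip) (hsub (mem_ball_iff_norm.2 hv))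
    (hsub (mem_ball_iff_norm.2 hw))

theorem exists_norm_duplication_sub_le (a b : ℂ) : ∃ K : ℝ, ∀ t : ℂ, ‖t‖ ≤ 1 →
    ‖duplication a b (t / 2, 1, (t / 2) ^ 3) - (t, 1, t ^ 3)‖ ≤ K * ‖t‖ ^ 4 := by
  -- The error of the jet (t, 1, t³) in the duplication equation, divided by t⁴.
  let R (t : ℂ) : ℂ × ℂ × ℂ :=
    (2 * (-3 * a * t / 32 - 9 * b * t ^ 3 / 128 + a ^ 2 * t ^ 5 / 512),
    (3 * a + 18 * b * (t / 2) ^ 2 + (t / 2) ^ 4 * (a + b * (t / 2) ^ 2) ^ 2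
      - 5 * a ^ 2 * (t / 2) ^ 4 - 4 * a * b * (t / 2) ^ 6
      - (8 * b ^ 2 + a ^ 3) * (t / 2) ^ 8) / 16, 0)
  have hR : Continuous R := by fun_prop
  obtain ⟨K, hK⟩ := (isCompact_closedBall (0 : ℂ) 1).exists_bound_of_continuousOn hR.continuousOn
  refine ⟨K, fun t ht => ?_⟩
  have : duplication a b (t / 2, 1, (t / 2) ^ 3) - (t, 1, t ^ 3) = t ^ 4 • R t := by
    simp only [duplication, R, Prod.mk_sub_mk, Prod.smul_mk, smul_eq_mul, Prod.mk.injEq]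
    refine ⟨?_, ?_, ?_⟩ <;> ring
  rw [this, norm_smul, norm_pow, mul_comm]
  gcongr
  exact hK t (by simpa using ht)

/-! ### Entire functions -/

theorem Differentiable.dslope {f : ℂ → ℂ} (hf : Differentiable ℂ f) (c : ℂ) :
    Differentiable ℂ (dslope f c) := by
  rw [← differentiableOn_univ] at hf ⊢
  exact (Complex.differentiableOn_dslope Filter.univ_mem).2 hf

open Filter Topology in
theorem exists_eq_pow_mul_of_isBigO (n : ℕ) : ∀ {f : ℂ → ℂ}, Differentiable ℂ f →
    (f =O[𝓝[≠] 0] fun t => t ^ n) →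
    ∃ g : ℂ → ℂ, Differentiable ℂ g ∧ ∀ t, f t = t ^ n * g t := by
  induction n with
  | zero => exact fun {f} hf _ => ⟨f, hf, by simp⟩
  | succ n ih =>
    intro f hf hO
    have h0 : f 0 = 0 := by
      have h1 : Tendsto (fun t : ℂ => t ^ (n + 1)) (𝓝[≠] 0) (𝓝 0) := by
        have : Continuous fun t : ℂ => t ^ (n + 1) := by fun_prop
        simpa using (this.tendsto 0).mono_left nhdsWithin_le_nhds
      exact tendsto_nhds_unique ((hf.continuous.tendsto 0).mono_left nhdsWithin_le_nhds)
        (hO.trans_tendsto h1)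
    have hf' (t : ℂ) : f t = t * dslope f 0 t := by
      have := sub_smul_dslope f 0 t
      simpa [h0] using this.symm
    obtain ⟨g, hg, hfg⟩ := ih (hf.dslope 0) (by
      obtain ⟨C, hC⟩ := hO.bound
      refine Asymptotics.IsBigO.of_bound C ?_
      filter_upwards [hC, self_mem_nhdsWithin] with t ht ht0
      have ht1 : 0 < ‖t‖ := norm_pos_iff.2 ht0
      rw [hf', norm_mul, pow_succ, norm_mul] at ht
      exact le_of_mul_le_mul_left (by linarith) ht1)
    exact ⟨g, hg, fun t => by rw [hf', hfg]; ring⟩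

theorem eq_zero_of_mul_eq_zero {f g : ℂ → ℂ} (hf : Differentiable ℂ f) (hg : Differentiable ℂ g)
    (h : ∀ t, f t * g t = 0) {t₀ : ℂ} (h0 : f t₀ ≠ 0) (t : ℂ) : g t = 0 := by
  rcases AnalyticOnNhd.eq_zero_or_eq_zero_of_mul_eq_zero
    (Complex.analyticOnNhd_univ_iff_differentiable.2 hf) (Complex.analyticOnNhd_univ_iff_differentiable.2 hg)
    (fun t _ => h t) isPreconnected_univ with h1 | h1
  · exact absurd (h1 t₀ trivial) h0
  · exact h1 t trivial

theorem isBigO_pow_of_eq_mul {e c : ℂ → ℂ} {n : ℕ} (hc : Continuous c)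
    (h : ∀ t, e t = t ^ n * c t) : e =O[nhds 0] fun t => t ^ n := by
  have h1 : c =O[nhds 0] fun _ => (1 : ℂ) := (hc.tendsto 0).isBigO_one ℂ
  have h2 : e = fun t => t ^ n * c t := funext h
  rw [h2]
  simpa using (Asymptotics.isBigO_refl (fun t : ℂ => t ^ n) (nhds 0)).mul h1

/-! ### The parametrization of a Weierstrass cubic by entire functions -/

/-- The quotient of `weierstrassCubic ∘ duplication` by `weierstrassCubic`. -/
def duplicationCofactor (a b X Y Z : ℂ) : ℂ :=
    -200 * X ^ 5 * Y ^ 3 * Z * a ^ 2 - 1600 * X ^ 4 * Y ^ 3 * Z ^ 2 * a * b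
    + 304 * X ^ 3 * Y ^ 3 * Z ^ 3 * a ^ 3 - 3200 * X ^ 3 * Y ^ 3 * Z ^ 3 * b ^ 2
    + 176 * X ^ 2 * Y ^ 5 * Z ^ 2 * a ^ 2 + 1296 * X ^ 2 * Y ^ 3 * Z ^ 4 * a ^ 2 * b
    - 152 * X * Y ^ 7 * Z * a + 496 * X * Y ^ 5 * Z ^ 3 * a * b
    - 136 * X * Y ^ 3 * Z ^ 5 * a ^ 4 + 168 * X * Y ^ 3 * Z ^ 5 * a * b ^ 2 + 8 * Y ^ 9
    - 536 * Y ^ 7 * Z ^ 2 * b - 144 * Y ^ 5 * Z ^ 4 * a ^ 3 - 616 * Y ^ 5 * Z ^ 4 * b ^ 2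
    - 112 * Y ^ 3 * Z ^ 6 * a ^ 3 * b - 392 * Y ^ 3 * Z ^ 6 * b ^ 3

/-- A polynomial identity, valid off the curve too, so it can be used before the parametrization is
known to lie on the curve. The duplication formulas have degree 4 and extend to infinity because x⁴
in the first coordinate and x⁶ in the second were rewritten by the curve equation. -/
theorem weierstrassCubic_duplication (a b X Y Z : ℂ) :
    weierstrassCubic a b (duplication a b (X, Y, Z)).1 (duplication a b (X, Y, Z)).2.1
      (duplication a b (X, Y, Z)).2.2 =
    duplicationCofactor a b X Y Z *
      weierstrassCubic a b X Y Z := by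
  simp only [duplication, duplicationCofactor, weierstrassCubic]
  ring

/-- Duplication has no base point on a smooth curve: the only candidates are the point at infinity
and the 2-torsion points Y = 0, and at the latter the second coordinate vanishes only if 3x² + a
does. -/
theorem eq_zero_of_duplication_eq_zero {a b : ℂ}
    (hs : ∀ x : ℂ, x ^ 3 + a * x + b = 0 → 3 * x ^ 2 + a ≠ 0) {X Y Z : ℂ}
    (hW : weierstrassCubic a b X Y Z = 0) (h : duplication a b (X, Y, Z) = 0) :
    (X, Y, Z) = 0 := by
  simp only [weierstrassCubic] at hW
  simp only [duplication, Prod.mk_eq_zero] at h ⊢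
  obtain ⟨-, h2, h3⟩ := h
  by_cases hZ : Z = 0
  · subst hZ
    have hX : X = 0 := by
      have : X ^ 3 = 0 := by linear_combination -hW
      simpa using this
    subst hX
    have hY : Y ^ 4 = 0 := by linear_combination h2
    simpa using hY
  · have hY : Y = 0 := by simpa [hZ] using h3
    subst hY
    exfalso
    refine hs (X / Z) ?_ ?_
    · field_simp
      linear_combination -hW
    · have : (3 * X ^ 2 + a * Z ^ 2) ^ 3 = 0 := by
        linear_combination -Z ^ 2 * h2 - (27 * X ^ 3 + 5 * a * X * Z ^ 2 - 7 * b * Z ^ 3) * hW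
      have h4 : 3 * X ^ 2 + a * Z ^ 2 = 0 := by simpa using this
      field_simp
      linear_combination h4

/-- A smooth Weierstrass cubic is parametrized by entire functions that integrate the invariant
differential. -/
theorem exists_weierstrass_parametrization {a b : ℂ}
    (hs : ∀ x : ℂ, x ^ 3 + a * x + b = 0 → 3 * x ^ 2 + a ≠ 0) :
    ∃ X Y Z : ℂ → ℂ, Differentiable ℂ X ∧ Differentiable ℂ Y ∧ Differentiable ℂ Z ∧
      (∀ t, weierstrassCubic a b (X t) (Y t) (Z t) = 0) ∧
      (∀ t, (X t, Y t, Z t) ≠ 0) ∧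
      (∀ t, deriv X t * Z t - X t * deriv Z t = -2 * Y t * Z t) ∧
      ∃ t, Y t * Z t ≠ 0 := by
  obtain ⟨δ, hδ, hLip⟩ := exists_lipschitz_duplication a b
  obtain ⟨K, hK⟩ := exists_norm_duplication_sub_le a b
  let i (t : ℂ) : ℂ × ℂ × ℂ := (t, 1, t ^ 3)
  have hi : Differentiable ℂ i := by unfold i; fun_prop
  obtain ⟨v, hv, hv2, hvO⟩ := exists_entire_two_mul_eq (differentiable_duplication a b) hi hδ
    (by simpa [i] using hLip) hK
  have hvO' : (fun t => v t - i t) =O[nhdsWithin 0 {0}ᶜ] fun t => t ^ 4 :=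
    hvO.mono nhdsWithin_le_nhds
  have hXd : Differentiable ℂ fun t => (v t).1 := by fun_prop
  have hYd : Differentiable ℂ fun t => (v t).2.1 := by fun_prop
  have hZd : Differentiable ℂ fun t => (v t).2.2 := by fun_prop
  obtain ⟨x, hx, hvx⟩ := exists_eq_pow_mul_of_isBigO 4 (f := fun t => (v t).1 - t) (by fun_prop)
    ((Asymptotics.isBigO_of_le _ fun t => norm_fst_le (v t - i t)).trans hvO')
  obtain ⟨y, hy, hvy⟩ := exists_eq_pow_mul_of_isBigO 4 (f := fun t => (v t).2.1 - 1) (by fun_prop)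
    ((Asymptotics.isBigO_of_le _ fun t =>
      (norm_fst_le (v t - i t).2).trans (norm_snd_le (v t - i t))).trans hvO')
  obtain ⟨z, hz, hvz⟩ := exists_eq_pow_mul_of_isBigO 4 (f := fun t => (v t).2.2 - t ^ 3)
    (by fun_prop) ((Asymptotics.isBigO_of_le _ fun t =>
      (norm_snd_le (v t - i t).2).trans (norm_snd_le (v t - i t))).trans hvO')
  obtain ⟨X, hXv⟩ : ∃ X : ℂ → ℂ, X = fun t => (v t).1 := ⟨_, rfl⟩
  obtain ⟨Y, hYv⟩ : ∃ Y : ℂ → ℂ, Y = fun t => (v t).2.1 := ⟨_, rfl⟩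
  obtain ⟨Z, hZv⟩ : ∃ Z : ℂ → ℂ, Z = fun t => (v t).2.2 := ⟨_, rfl⟩
  have hvXYZ (t : ℂ) : v t = (X t, Y t, Z t) := by rw [hXv, hYv, hZv]
  rw [← hXv] at hXd
  rw [← hYv] at hYd
  rw [← hZv] at hZd
  have hX (t : ℂ) : X t = t + t ^ 4 * x t := by rw [hXv, ← hvx]; ring
  have hY (t : ℂ) : Y t = 1 + t ^ 4 * y t := by rw [hYv, ← hvy]; ring
  have hZ (t : ℂ) : Z t = t ^ 3 + t ^ 4 * z t := by rw [hZv, ← hvz]; ring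
  have hdup (t : ℂ) : (X (2 * t), Y (2 * t), Z (2 * t)) = duplication a b (X t, Y t, Z t) := by
    rw [← hvXYZ, ← hvXYZ, hv2]
  clear hvx hvy hvz hvO hvO' hXv hYv hZv hv2 hvXYZ hv hLip hK
  have hxc := hx.continuous
  have hyc := hy.continuous
  have hzc := hz.continuous
  have hXc := hXd.continuous
  have hYc := hYd.continuous
  have hZc := hZd.continuous
  have hX0 : X 0 = 0 := by simp [hX]
  have hY0 : Y 0 = 1 := by simp [hY]
  have hZ0 : Z 0 = 0 := by simp [hZ]
  have hW : ∀ t, weierstrassCubic a b (X t) (Y t) (Z t) = 0 := by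
    -- The cofactor is 8 < 9 at the initial point (0, 1, 0); `c` is the cubic divided by t⁴ after
    -- inserting the expansions of X, Y, Z.
    refine eq_zero_of_two_mul_eq (G := fun t => duplicationCofactor a b (X t) (Y t) (Z t))
      (isBigO_pow_of_eq_mul (c := fun t =>
      z t + (2 * y t + t ^ 4 * y t ^ 2) * (t ^ 3 + t ^ 4 * z t) -
      t ^ 2 * (3 * x t + 3 * t ^ 3 * x t ^ 2 + t ^ 6 * x t ^ 3) -
      a * t ^ 3 * (1 + t ^ 3 * x t) * (1 + t * z t) ^ 2 - b * t ^ 5 * (1 + t * z t) ^ 3)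
      (by fun_prop) fun t => ?_) ?_ ?_ fun t => ?_
    · simp only [weierstrassCubic, hX, hY, hZ]
      ring
    · unfold duplicationCofactor
      exact Continuous.continuousAt (by fun_prop)
    · simp only [duplicationCofactor, hX0, hY0, hZ0]
      norm_num
    · have h1 := congrArg Prod.fst (hdup t)
      have h2 := congrArg (fun p : ℂ × ℂ × ℂ => p.2.1) (hdup t)
      have h3 := congrArg (fun p : ℂ × ℂ × ℂ => p.2.2) (hdup t)
      simp only at h1 h2 h3
      rw [h1, h2, h3, weierstrassCubic_duplication]
  have hne : ∀ t, (X t, Y t, Z t) ≠ 0 := by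
    have hYne : ∀ᶠ t in nhds (0 : ℂ), Y t ≠ 0 :=
      hYc.continuousAt.eventually_ne (by rw [hY0]; exact one_ne_zero)
    obtain ⟨r, hr, hball⟩ := Metric.eventually_nhds_iff.1 hYne
    refine forall_of_forall_two_mul hr (fun t ht h => ?_) fun t ht h => ?_
    · exact hball (by simpa using ht) (congrArg (fun p : ℂ × ℂ × ℂ => p.2.1) h)
    · rw [hdup] at h
      exact ht (eq_zero_of_duplication_eq_zero hs (hW t) h)
  have hXD (t : ℂ) : HasDerivAt X (deriv X t) t := (hXd t).hasDerivAt
  have hYD (t : ℂ) : HasDerivAt Y (deriv Y t) t := (hYd t).hasDerivAt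
  have hZD (t : ℂ) : HasDerivAt Z (deriv Z t) t := (hZd t).hasDerivAt
  have hderiv {f : ℂ → ℂ} (hf : ∀ t, HasDerivAt f (deriv f t) t) (t : ℂ) :
      HasDerivAt (fun t => f (2 * t)) (2 * deriv f (2 * t)) t := by
    have h1 : HasDerivAt (fun t : ℂ => 2 * t) 2 t := by
      simpa using (hasDerivAt_id t).const_mul 2
    rw [mul_comm]
    exact (hf (2 * t)).comp t h1
  have hZ2 (t : ℂ) : 2 * deriv Z (2 * t) =
      8 * (3 * Y t ^ 2 * deriv Y t * Z t + Y t ^ 3 * deriv Z t) := by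
    have h1 : (fun t => Z (2 * t)) = fun t => 8 * (Y t ^ 3 * Z t) := by
      funext t
      have := congrArg (fun p : ℂ × ℂ × ℂ => p.2.2) (hdup t)
      simp only [duplication] at this
      rw [this]
      ring
    have h2 := hderiv hZD t
    rw [h1] at h2
    have h3 := (((hYD t).pow 3).mul (hZD t)).const_mul 8
    rw [h2.unique h3]
    simp
  have hX2 (t : ℂ) : 2 * deriv X (2 * t) = 2 * (deriv Y t * (X t * Y t ^ 2 -
        3 * a * X t ^ 2 * Z t - 9 * b * X t * Z t ^ 2 + a ^ 2 * Z t ^ 3) +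
      Y t * (deriv X t * Y t ^ 2 + 2 * X t * Y t * deriv Y t - 6 * a * X t * deriv X t * Z t -
        3 * a * X t ^ 2 * deriv Z t - 9 * b * deriv X t * Z t ^ 2 -
        18 * b * X t * Z t * deriv Z t + 3 * a ^ 2 * Z t ^ 2 * deriv Z t)) := by
    have h1 : (fun t => X (2 * t)) = fun t => 2 * (Y t * (X t * Y t ^ 2 -
        3 * a * (X t ^ 2 * Z t) - 9 * b * (X t * Z t ^ 2) + a ^ 2 * Z t ^ 3)) := by
      funext t
      have := congrArg (fun p : ℂ × ℂ × ℂ => p.1) (hdup t)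
      simp only [duplication] at this
      rw [this]
      ring
    have h2 := hderiv hXD t
    rw [h1] at h2
    have h3 := ((hYD t).mul (((((hXD t).mul ((hYD t).pow 2)).sub
      ((((hXD t).pow 2).mul (hZD t)).const_mul (3 * a))).sub
      (((hXD t).mul ((hZD t).pow 2)).const_mul (9 * b))).add
      (((hZD t).pow 3).const_mul (a ^ 2)))).const_mul 2
    rw [h2.unique h3]
    simp
    ring
  have hdW (t : ℂ) : 2 * Y t * deriv Y t * Z t + Y t ^ 2 * deriv Z t - 3 * X t ^ 2 * deriv X t -
      a * deriv X t * Z t ^ 2 - 2 * a * X t * Z t * deriv Z t - 3 * b * Z t ^ 2 * deriv Z t = 0 := by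
    have h1 := ((((((hYD t).pow 2).mul (hZD t)).sub ((hXD t).pow 3)).sub
      (((hXD t).const_mul a).mul ((hZD t).pow 2))).sub (((hZD t).pow 3).const_mul b))
    have h2 := h1.congr_of_eventuallyEq (f₁ := fun _ => (0 : ℂ)) (Filter.Eventually.of_forall
      fun t => (hW t).symm)
    rw [← h2.unique (hasDerivAt_const t 0)]
    simp
    ring
  refine ⟨X, Y, Z, hXd, hYd, hZd, hW, hne, ?_, ?_⟩
  -- With x = X/Z and y = Y/Z this says x' = −2y. Duplication doubles the invariant differential, so
  -- the defect satisfies a doubling equation, with multiplier 8 at t = 0.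
  · have hD : ∀ t, deriv X t * Z t - X t * deriv Z t + 2 * Y t * Z t = 0 := by
      have hdX (t : ℂ) : deriv X t = 1 + (4 * t ^ 3 * x t + t ^ 4 * deriv x t) := by
        have h1 := (hasDerivAt_id t).add (((hasDerivAt_id t).pow 4).mul (hx t).hasDerivAt)
        have h2 : HasDerivAt X (1 + (4 * t ^ 3 * x t + t ^ 4 * deriv x t)) t := by
          rw [funext hX]
          exact h1.congr_deriv (by simp)
        exact h2.deriv
      have hdZ (t : ℂ) : deriv Z t = 3 * t ^ 2 + (4 * t ^ 3 * z t + t ^ 4 * deriv z t) := by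
        have h1 := ((hasDerivAt_id t).pow 3).add (((hasDerivAt_id t).pow 4).mul (hz t).hasDerivAt)
        have h2 : HasDerivAt Z (3 * t ^ 2 + (4 * t ^ 3 * z t + t ^ 4 * deriv z t)) t := by
          rw [funext hZ]
          exact h1.congr_deriv (by simp)
        exact h2.deriv
      have hdxc : Continuous (deriv x) := hx.deriv.continuous
      have hdzc : Continuous (deriv z) := hz.deriv.continuous
      refine eq_zero_of_two_mul_eq (G := fun t => 8 * Y t ^ 2 * Y (2 * t))
        (isBigO_pow_of_eq_mul (c := fun t =>
          z t + (4 * t ^ 2 * x t + t ^ 3 * deriv x t) +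
          t * (4 * t ^ 2 * x t + t ^ 3 * deriv x t) * z t - (4 * z t + t * deriv z t) -
          t ^ 2 * x t * (3 + t * (4 * z t + t * deriv z t)) + 2 * z t +
          2 * t ^ 3 * y t * (1 + t * z t)) (by fun_prop) fun t => ?_) ?_ ?_ fun t => ?_
      · simp only [hdX, hdZ, hX, hY, hZ]
        ring
      · exact Continuous.continuousAt (by fun_prop)
      · simp only [mul_zero, hY0]
        norm_num
      · have h1 := congrArg Prod.fst (hdup t)
        have h2 := congrArg (fun p : ℂ × ℂ × ℂ => p.2.1) (hdup t)
        have h3 := congrArg (fun p : ℂ × ℂ × ℂ => p.2.2) (hdup t)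
        simp only [duplication] at h1 h2 h3
        have hW' := hW t
        simp only [weierstrassCubic] at hW'
        have hR : 2 * Y t * Z t * (deriv Y t * Z t - Y t * deriv Z t) =
            (3 * X t ^ 2 + a * Z t ^ 2) * (deriv X t * Z t - X t * deriv Z t) := by
          linear_combination Z t * hdW t - 3 * deriv Z t * hW'
        have hX2' : deriv X (2 * t) = _ := mul_left_cancel₀ two_ne_zero (hX2 t)
        have hZ2' : deriv Z (2 * t) =
            4 * (3 * Y t ^ 2 * deriv Y t * Z t + Y t ^ 3 * deriv Z t) := by
          linear_combination hZ2 t / 2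
        rw [hX2', hZ2', h1, h2, h3]
        linear_combination 8 * Y t ^ 2 * (3 * a * X t ^ 2 + 9 * b * X t * Z t - a ^ 2 * Z t ^ 2) * hR
          - 8 * Y t ^ 2 * (4 * a * X t + 7 * b * Z t) * (deriv X t * Z t - X t * deriv Z t) * hW'
    intro t
    linear_combination hD t
  · by_contra! h
    -- As Y(0) = 1, the factor Z would vanish identically, against Z = t³(1 + t z).
    have hZ' := eq_zero_of_mul_eq_zero hYd hZd h (t₀ := 0) (by rw [hY0]; exact one_ne_zero)
    have h1 := eq_zero_of_mul_eq_zero (f := fun t => t ^ 3) (g := fun t => 1 + t * z t)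
      (by fun_prop) (by fun_prop) (fun t => by rw [← hZ' t, hZ]; ring) (t₀ := 1) (by simp) 0
    simp at h1

/-! ### Interpolation at simple zeros -/

section Interpolation

open Filter Topology

theorem finite_zeros_inter_closedBall {A : ℂ → ℂ} (hA : Differentiable ℂ A)
    (hsimple : ∀ t, A t = 0 → deriv A t ≠ 0) (R : ℝ) :
    ({t | A t = 0} ∩ Metric.closedBall 0 R).Finite := by
  refine IsCompact.finite ((isCompact_closedBall 0 R).inter_left
    (isClosed_eq hA.continuous continuous_const)) ?_
  rw [isDiscrete_iff_nhdsNE]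
  rintro t ⟨ht, -⟩
  have h1 := (hA t).hasDerivAt.eventually_ne (c := 0) (hsimple t ht)
  rw [← disjoint_iff, Filter.disjoint_principal_right]
  filter_upwards [h1] with s hs hs'
  exact hs hs'.1

/-- A Mittag-Leffler type series: A(t)/(t − w) vanishes at every zero of A except w, where its value
is A'(w). The factors (t/w)ⁿ equal 1 at w and enforce convergence. -/
theorem exists_entire_interpolation {A : ℂ → ℂ} (hA : Differentiable ℂ A)
    (hsimple : ∀ t, A t = 0 → deriv A t ≠ 0) (c : ℂ → ℂ) :
    ∃ g : ℂ → ℂ, Differentiable ℂ g ∧ ∀ t, A t = 0 → g t = c t := by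
  let S : Set ℂ := {t | A t = 0}
  have hfin := finite_zeros_inter_closedBall hA hsimple
  have hcount : S.Countable := by
    have : S = ⋃ n : ℕ, S ∩ Metric.closedBall 0 n := by
      rw [← Set.inter_iUnion, Metric.iUnion_closedBall_nat, Set.inter_univ]
    rw [this]
    exact Set.countable_iUnion fun n => (hfin n).countable
  have : Countable S := hcount.to_subtype
  obtain ⟨ε, hε, e, hsum, -⟩ := NNReal.exists_pos_sum_of_countable one_ne_zero S
  have hsum' : Summable fun w : S => (ε w : ℝ) := NNReal.summable_coe.2 hsum.summable
  -- The exponent at w = 0 has to be 0: since t / 0 = 0, only then is the factor 1.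
  have hn : ∀ w : S, ∃ n : ℕ, (w.1 = 0 → n = 0) ∧
      (w.1 ≠ 0 → ‖c w / deriv A w‖ * (1 / 2 : ℝ) ^ n ≤ ε w) := by
    intro w
    by_cases hw : w.1 = 0
    · exact ⟨0, fun _ => rfl, fun h => absurd hw h⟩
    · have hlim : Tendsto (fun n : ℕ => ‖c w / deriv A w‖ * (1 / 2 : ℝ) ^ n) atTop
          (𝓝 (‖c w / deriv A w‖ * 0)) :=
        (tendsto_pow_atTop_nhds_zero_of_lt_one (by norm_num) (by norm_num)).const_mul _
      rw [mul_zero] at hlim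
      obtain ⟨n, hn⟩ := (hlim.eventually_le_const (NNReal.coe_pos.2 (hε w))).exists
      exact ⟨n, fun h => absurd h hw, fun _ => hn⟩
  choose n hn0 hn using hn
  let T (w : S) (t : ℂ) : ℂ := c w / deriv A w * dslope A w t * (t / w) ^ n w
  have hT (w : S) : Differentiable ℂ (T w) :=
    ((hA.dslope w.1).const_mul _).mul ((differentiable_id.div_const w.1).pow _)
  refine ⟨fun t => ∑' w : S, T w t, fun t₀ => ?_, fun t₀ ht₀ => ?_⟩
  · obtain ⟨R, hR⟩ : ∃ R, ‖t₀‖ < R := exists_gt _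
    have hR0 : 0 < R := (norm_nonneg _).trans_lt hR
    obtain ⟨M, hM⟩ := (isCompact_closedBall (0 : ℂ) R).exists_bound_of_continuousOn
      hA.continuous.continuousOn
    have hK : ∀ w : S, ∃ K, ∀ t ∈ Metric.closedBall (0 : ℂ) R, ‖T w t‖ ≤ K := fun w =>
      (isCompact_closedBall (0 : ℂ) R).exists_bound_of_continuousOn (hT w).continuous.continuousOn
    choose K hK using hK
    -- Only finitely many w satisfy ‖w‖ ≤ 2R; for the others ‖t − w‖ ≥ R and ‖t/w‖ ≤ 1/2 on the
    -- disc.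
    let u (w : S) : ℝ := if ‖w.1‖ ≤ 2 * R then K w else M / R * ε w
    have hu : Summable u := by
      refine (hsum'.mul_left (M / R)).congr_cofinite ?_
      have hfin' : {w : S | ‖w.1‖ ≤ 2 * R}.Finite := by
        refine Set.Finite.of_finite_image (f := Subtype.val) ((hfin (2 * R)).subset ?_)
          Subtype.val_injective.injOn
        rintro _ ⟨w, hw, rfl⟩
        exact ⟨w.2, by simpa using hw⟩
      filter_upwards [hfin'.compl_mem_cofinite] with w hw
      exact (if_neg hw).symm
    refine (Complex.differentiableOn_tsum_of_summable_norm (U := Metric.ball 0 R) hu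
      (fun w => (hT w).differentiableOn) Metric.isOpen_ball fun w t ht => ?_).differentiableAt
      (Metric.isOpen_ball.mem_nhds (by simpa using hR))
    by_cases hw : ‖w.1‖ ≤ 2 * R
    · simp only [u, if_pos hw]
      exact hK w t (Metric.ball_subset_closedBall ht)
    · simp only [u, if_neg hw]
      have hw0 : w.1 ≠ 0 := by
        intro h
        rw [h, norm_zero] at hw
        exact hw (by positivity)
      have htR : ‖t‖ < R := by simpa using ht
      have hne : t ≠ w.1 := by
        rintro rfl
        linarith
      have h1 : ‖dslope A w.1 t‖ ≤ M / R := by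
        rw [dslope_of_ne _ hne, slope_def_field, show A w.1 = 0 from w.2, sub_zero, norm_div]
        have h2 : R ≤ ‖t - w.1‖ := by
          have := norm_sub_norm_le w.1 t
          rw [norm_sub_rev] at this
          linarith
        have h3 := hM t (Metric.ball_subset_closedBall ht)
        exact div_le_div₀ ((norm_nonneg _).trans h3) h3 hR0 h2
      have h2 : ‖(t / w.1) ^ n w‖ ≤ (1 / 2 : ℝ) ^ n w := by
        rw [norm_pow, norm_div]
        refine pow_le_pow_left₀ (by positivity) ?_ _
        rw [div_le_iff₀ (norm_pos_iff.2 hw0)]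
        linarith
      have hMR : 0 ≤ M / R := (norm_nonneg _).trans h1
      calc ‖T w t‖ = ‖dslope A w.1 t‖ * (‖c w / deriv A w‖ * ‖(t / w.1) ^ n w‖) := by
            simp only [T, norm_mul]
            ring
        _ ≤ M / R * (‖c w / deriv A w‖ * (1 / 2 : ℝ) ^ n w) := by gcongr
        _ ≤ M / R * ε w := by
            gcongr
            exact hn w hw0
  · have hval : T ⟨t₀, ht₀⟩ t₀ = c t₀ := by
      have h1 := hsimple t₀ ht₀
      have h2 : (t₀ / t₀) ^ n ⟨t₀, ht₀⟩ = 1 := by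
        by_cases h : t₀ = 0
        · rw [hn0 ⟨t₀, ht₀⟩ h, pow_zero]
        · rw [div_self h, one_pow]
      simp only [T, dslope_same, h2, mul_one]
      field_simp
    refine (tsum_eq_single (⟨t₀, ht₀⟩ : S) fun w hw => ?_).trans hval
    have hne : t₀ ≠ w.1 := fun h => hw (Subtype.ext h.symm)
    simp [T, dslope_of_ne _ hne, slope_def_field, show A w.1 = 0 from w.2, show A t₀ = 0 from ht₀]

theorem exists_entire_quotient {A h : ℂ → ℂ} (hA : Differentiable ℂ A) (hh : Differentiable ℂ h)
    (hsimple : ∀ t, A t = 0 → deriv A t ≠ 0) (hzero : ∀ t, A t = 0 → h t = 0) :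
    ∃ q : ℂ → ℂ, Differentiable ℂ q ∧ ∀ t, A t * q t = h t := by
  classical
  refine ⟨fun t => if A t = 0 then deriv h t / deriv A t else h t / A t, fun t₀ => ?_,
    fun t => ?_⟩
  · by_cases h0 : A t₀ = 0
    · have h1 : DifferentiableAt ℂ (fun t => dslope h t₀ t / dslope A t₀ t) t₀ :=
        (hh.dslope t₀ t₀).div (hA.dslope t₀ t₀) (by simpa using hsimple t₀ h0)
      refine h1.congr_of_eventuallyEq ?_
      have h2 := (hA t₀).hasDerivAt.eventually_ne (c := 0) (hsimple t₀ h0)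
      rw [eventually_nhdsWithin_iff] at h2
      filter_upwards [h2] with t ht
      by_cases hne : t = t₀
      · subst hne
        simp [h0]
      · have := sub_ne_zero.2 hne
        rw [if_neg (ht hne), dslope_of_ne _ hne, dslope_of_ne _ hne, slope_def_field,
          slope_def_field, h0, hzero t₀ h0, sub_zero, sub_zero,
          div_div_div_cancel_right₀ this]
    · refine ((hh t₀).div (hA t₀) h0).congr_of_eventuallyEq ?_
      filter_upwards [hA.continuous.continuousAt.eventually_ne h0] with t ht
      simp [ht]
  · by_cases h0 : A t = 0
    · simp [h0, hzero t h0]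
    · simp only [if_neg h0]
      field_simp

end Interpolation

/-! ### Tangent lines of a Weierstrass cubic -/

/-- The Hessian cubic of `weierstrassCubic`, up to a constant factor. -/
def weierstrassHessian (a b x y z : ℂ) : ℂ :=
  -(3 * x * y ^ 2 + 3 * a * x ^ 2 * z + 9 * b * x * z ^ 2 - a ^ 2 * z ^ 3)

/-- Entire functions `X`, `Y`, `Z` that parametrize the curve `Y²Z = X³ + aXZ² + bZ³` by the
integral of its invariant differential. -/
structure IsWeierstrassParametrization (a b : ℂ) (X Y Z : ℂ → ℂ) : Prop where
  smooth : ∀ x : ℂ, x ^ 3 + a * x + b = 0 → 3 * x ^ 2 + a ≠ 0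
  diffX : Differentiable ℂ X
  diffY : Differentiable ℂ Y
  diffZ : Differentiable ℂ Z
  cubic : ∀ t, weierstrassCubic a b (X t) (Y t) (Z t) = 0
  ne_zero : ∀ t, (X t, Y t, Z t) ≠ 0
  wronskian : ∀ t, deriv X t * Z t - X t * deriv Z t = -2 * Y t * Z t
  exists_ne : ∃ t, Y t * Z t ≠ 0

namespace IsWeierstrassParametrization

variable {a b : ℂ} {X Y Z : ℂ → ℂ} (h : IsWeierstrassParametrization a b X Y Z)
include h

theorem diffYZ : Differentiable ℂ fun t => Y t * Z t := h.diffY.mul h.diffZ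

/-- Cancels the denominators: identities along the curve are checked after multiplication by YZ,
where they follow from the cubic and the Wronskians. -/
theorem eq_zero_of_mul {g : ℂ → ℂ} (hg : Differentiable ℂ g)
    (h0 : ∀ t, Y t * Z t * g t = 0) (t : ℂ) : g t = 0 :=
  h.exists_ne.elim fun _ ht => eq_zero_of_mul_eq_zero h.diffYZ hg h0 ht t

theorem gradient_deriv (t : ℂ) : 2 * Y t * deriv Y t * Z t + Y t ^ 2 * deriv Z t -
    3 * X t ^ 2 * deriv X t - a * deriv X t * Z t ^ 2 - 2 * a * X t * Z t * deriv Z t -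
    3 * b * Z t ^ 2 * deriv Z t = 0 := by
  have hX := (h.diffX t).hasDerivAt
  have hY := (h.diffY t).hasDerivAt
  have hZ := (h.diffZ t).hasDerivAt
  have h1 := ((((hY.pow 2).mul hZ).sub (hX.pow 3)).sub
    ((hX.const_mul a).mul (hZ.pow 2))).sub ((hZ.pow 3).const_mul b)
  have h2 := h1.congr_of_eventuallyEq (f₁ := fun _ => (0 : ℂ)) (Filter.Eventually.of_forall
    fun t => (h.cubic t).symm)
  rw [← h2.unique (hasDerivAt_const t 0)]
  simp
  ring

/-- In affine terms y' = −(3x² + a), from differentiating the curve equation and x' = −2y. -/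
theorem wronskianYZ (t : ℂ) :
    deriv Y t * Z t - Y t * deriv Z t = -(3 * X t ^ 2 + a * Z t ^ 2) := by
  have hX := h.diffX
  have hY := h.diffY
  have hZ := h.diffZ
  have hY' := hY.deriv
  have hZ' := hZ.deriv
  have key := h.eq_zero_of_mul (g := fun t =>
    deriv Y t * Z t - Y t * deriv Z t + (3 * X t ^ 2 + a * Z t ^ 2)) (by fun_prop) (fun t => by
      have hW := h.cubic t
      simp only [weierstrassCubic] at hW
      linear_combination Z t / 2 * h.gradient_deriv t - 3 / 2 * deriv Z t * hW +
        (3 * X t ^ 2 + a * Z t ^ 2) / 2 * h.wronskian t) t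
  linear_combination key

/-- Needed at the point at infinity, where Z = 0 and the affine relations are silent. -/
theorem wronskianXY (t : ℂ) :
    X t * deriv Y t - deriv X t * Y t = -Y t ^ 2 + 2 * a * X t * Z t + 3 * b * Z t ^ 2 := by
  have hX := h.diffX
  have hY := h.diffY
  have hZ := h.diffZ
  have hX' := hX.deriv
  have hY' := hY.deriv
  have key := h.eq_zero_of_mul (g := fun t =>
    X t * deriv Y t - deriv X t * Y t - (-Y t ^ 2 + 2 * a * X t * Z t + 3 * b * Z t ^ 2))
    (by fun_prop) (fun t => by
      have hW := h.cubic t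
      simp only [weierstrassCubic] at hW
      linear_combination Y t * X t * h.wronskianYZ t - Y t * Y t * h.wronskian t +
        3 * Y t * hW) t
  linear_combination key

/-- The Hessian along the parametrization. -/
theorem hessian_eq (t : ℂ) :
    2 * Y t * deriv Y t * deriv Z t + deriv Y t ^ 2 * Z t - 3 * X t * deriv X t ^ 2 -
      a * (X t * deriv Z t ^ 2 + 2 * deriv X t * Z t * deriv Z t) - 3 * b * Z t * deriv Z t ^ 2 =
    weierstrassHessian a b (X t) (Y t) (Z t) := by
  have hX := h.diffX
  have hY := h.diffY
  have hZ := h.diffZ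
  have hX' := hX.deriv
  have hY' := hY.deriv
  have hZ' := hZ.deriv
  -- The extra factor YZ in g makes the identity polynomial in the known relations; it is cancelled
  -- by a second application.
  have key := h.eq_zero_of_mul (g := fun t => Y t * Z t * (2 * Y t * deriv Y t * deriv Z t +
      deriv Y t ^ 2 * Z t - 3 * X t * deriv X t ^ 2 -
      a * (X t * deriv Z t ^ 2 + 2 * deriv X t * Z t * deriv Z t) - 3 * b * Z t * deriv Z t ^ 2 -
      weierstrassHessian a b (X t) (Y t) (Z t))) (by unfold weierstrassHessian; fun_prop)
    (fun t => by
      have hW := h.cubic t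
      simp only [weierstrassCubic] at hW
      have e1 := h.wronskian t
      have e2 := h.wronskianYZ t
      simp only [weierstrassHessian]
      linear_combination Y t ^ 2 * ((2 * Y t * Z t * deriv Z t + Z t * (deriv Y t * Z t +
        Y t * deriv Z t - (3 * X t ^ 2 + a * Z t ^ 2))) * e2 +
        (-3 * X t * (deriv X t * Z t + X t * deriv Z t - 2 * Y t * Z t) -
          2 * a * Z t ^ 2 * deriv Z t) * e1 +
        (3 * deriv Z t ^ 2 - 9 * X t * Z t) * hW))
  have key2 := h.eq_zero_of_mul (by unfold weierstrassHessian; fun_prop) key t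
  linear_combination key2

theorem differentiable_hessian :
    Differentiable ℂ fun t => weierstrassHessian a b (X t) (Y t) (Z t) := by
  have hX := h.diffX
  have hY := h.diffY
  have hZ := h.diffZ
  unfold weierstrassHessian
  fun_prop

theorem deriv_hessian (t : ℂ) : deriv (fun t => weierstrassHessian a b (X t) (Y t) (Z t)) t =
    -(3 * deriv X t * Y t ^ 2 + 6 * X t * Y t * deriv Y t + 6 * a * X t * deriv X t * Z t +
      3 * a * X t ^ 2 * deriv Z t + 9 * b * deriv X t * Z t ^ 2 + 18 * b * X t * Z t * deriv Z t -
      3 * a ^ 2 * Z t ^ 2 * deriv Z t) := by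
  have hX := (h.diffX t).hasDerivAt
  have hY := (h.diffY t).hasDerivAt
  have hZ := (h.diffZ t).hasDerivAt
  have h1 := (((((hX.const_mul 3).mul (hY.pow 2)).add (((hX.pow 2).const_mul (3 * a)).mul hZ)).add
    ((hX.const_mul (9 * b)).mul (hZ.pow 2))).sub ((hZ.pow 3).const_mul (a ^ 2))).neg
  refine (HasDerivAt.congr_deriv (f := fun t => weierstrassHessian a b (X t) (Y t) (Z t)) h1
    ?_).deriv
  simp
  ring

/-- The Hessian divided by Z³ is −(3x⁴ + 6ax² + 12bx − a²), minus the 3-division polynomial, and its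
derivative is 24y³. -/
theorem mul_deriv_hessian (t : ℂ) :
    Z t ^ 3 * deriv (fun t => weierstrassHessian a b (X t) (Y t) (Z t)) t =
      Z t ^ 2 * (3 * deriv Z t * weierstrassHessian a b (X t) (Y t) (Z t) +
        24 * Y t ^ 3 * Z t) := by
  have hW := h.cubic t
  simp only [weierstrassCubic] at hW
  rw [h.deriv_hessian]
  simp only [weierstrassHessian]
  linear_combination -Z t ^ 2 * (3 * Y t ^ 2 + 6 * a * X t * Z t + 9 * b * Z t ^ 2) *
    h.wronskian t - 6 * Z t ^ 2 * X t * Y t * h.wronskianYZ t - 18 * Z t ^ 2 * Y t * hW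

/-- Rescaling V by a function changes both sides alike. For Z = 1 the vector V' is (−2y, y', 0), so
the left side is −3x'³ = 24y³, the derivative of the Hessian. -/
theorem cubic_deriv (t : ℂ) : 3 * weierstrassCubic a b (deriv X t) (deriv Y t) (deriv Z t) =
    deriv (fun t => weierstrassHessian a b (X t) (Y t) (Z t)) t := by
  have hX := h.diffX
  have hY := h.diffY
  have hZ := h.diffZ
  have hX' := hX.deriv
  have hY' := hY.deriv
  have hZ' := hZ.deriv
  have hA' := h.differentiable_hessian.deriv
  have hdiff : Differentiable ℂ fun t =>
      3 * weierstrassCubic a b (deriv X t) (deriv Y t) (deriv Z t) -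
        deriv (fun t => weierstrassHessian a b (X t) (Y t) (Z t)) t := by
    unfold weierstrassCubic
    fun_prop
  have key (t : ℂ) : Z t ^ 3 * (3 * weierstrassCubic a b (deriv X t) (deriv Y t) (deriv Z t) -
        deriv (fun t => weierstrassHessian a b (X t) (Y t) (Z t)) t) = 0 := by
    have hW := h.cubic t
    simp only [weierstrassCubic] at hW
    have e1 := h.wronskian t
    have e2 := h.wronskianYZ t
    rw [mul_sub, h.mul_deriv_hessian]
    simp only [weierstrassHessian, weierstrassCubic]
    linear_combination 3 * (deriv Y t * Z t + Y t * deriv Z t - (3 * X t ^ 2 + a * Z t ^ 2)) * Z t *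
        deriv Z t * e2 -
      3 * ((deriv X t * Z t) ^ 2 + deriv X t * Z t * (X t * deriv Z t - 2 * Y t * Z t) +
        (X t * deriv Z t - 2 * Y t * Z t) ^ 2 + a * Z t ^ 2 * deriv Z t ^ 2) * e1 +
      (3 * deriv Z t ^ 3 - 27 * X t * Z t * deriv Z t) * hW
  obtain ⟨t₀, ht₀⟩ := h.exists_ne
  have := eq_zero_of_mul_eq_zero (hZ.pow 3) hdiff key (pow_ne_zero 3 (right_ne_zero_of_mul ht₀)) t
  linear_combination this

/-- A multiple zero at a finite point would have y = 0 and then 3x² + a = 0, a singular point;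
infinity is handled by `wronskianXY`. -/
theorem deriv_hessian_ne_zero (t : ℂ) (ht : weierstrassHessian a b (X t) (Y t) (Z t) = 0) :
    deriv (fun t => weierstrassHessian a b (X t) (Y t) (Z t)) t ≠ 0 := by
  intro h0
  have hW := h.cubic t
  simp only [weierstrassCubic] at hW
  by_cases hZ : Z t = 0
  · have hX : X t = 0 := by
      rw [hZ] at hW
      have : X t ^ 3 = 0 := by linear_combination -hW
      simpa using this
    have hY : Y t ≠ 0 := fun hY => h.ne_zero t (by rw [hX, hY, hZ]; rfl)
    have h1 := h.wronskianXY t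
    rw [h.deriv_hessian, hX, hZ] at h0
    rw [hX, hZ] at h1
    have : Y t ^ 4 = 0 := by linear_combination Y t ^ 2 * h1 - Y t / 3 * h0
    exact hY (by simpa using this)
  · have h1 := h.mul_deriv_hessian t
    rw [h0, ht] at h1
    have hY : Y t = 0 := by
      have h2 : Y t ^ 3 * Z t ^ 3 = 0 := by linear_combination -h1 / 24
      simpa [hZ] using h2
    refine h.smooth (X t / Z t) ?_ ?_
    · field_simp
      rw [hY] at hW
      linear_combination -hW
    · simp only [weierstrassHessian] at ht
      rw [hY] at ht hW
      have h2 : (3 * X t ^ 2 + a * Z t ^ 2) ^ 2 = 0 := by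
        linear_combination Z t * ht - 9 * X t * hW
      have h3 : 3 * X t ^ 2 + a * Z t ^ 2 = 0 := by simpa using h2
      field_simp
      linear_combination h3

/-- The cubic form on the tangent line is affine in the coordinate along the line. -/
theorem cubic_tangent (t c : ℂ) :
    weierstrassCubic a b (c * X t + deriv X t) (c * Y t + deriv Y t) (c * Z t + deriv Z t) =
      c * weierstrassHessian a b (X t) (Y t) (Z t) +
        deriv (fun t => weierstrassHessian a b (X t) (Y t) (Z t)) t / 3 := by
  have h1 := h.cubic t
  have h2 := h.gradient_deriv t
  have h3 := h.cubic_deriv t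
  rw [← h.hessian_eq, ← h3]
  simp only [weierstrassCubic] at h1 ⊢
  linear_combination c ^ 3 * h1 + c ^ 2 * h2

/-- The derivative of ∇f(V)·V' = 0. It shows that V'' leaves the tangent plane spanned by V and V'
wherever the Hessian is nonzero. -/
theorem gradient_deriv_deriv (t : ℂ) :
    (-3 * X t ^ 2 - a * Z t ^ 2) * deriv (deriv X) t + 2 * Y t * Z t * deriv (deriv Y) t +
      (Y t ^ 2 - 2 * a * X t * Z t - 3 * b * Z t ^ 2) * deriv (deriv Z) t =
    -2 * weierstrassHessian a b (X t) (Y t) (Z t) := by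
  have hX := (h.diffX t).hasDerivAt
  have hY := (h.diffY t).hasDerivAt
  have hZ := (h.diffZ t).hasDerivAt
  have hX' := (h.diffX.deriv t).hasDerivAt
  have hY' := (h.diffY.deriv t).hasDerivAt
  have hZ' := (h.diffZ.deriv t).hasDerivAt
  have h1 := (((((((hY.const_mul 2).mul hY').mul hZ).add ((hY.pow 2).mul hZ')).sub
    (((hX.pow 2).const_mul 3).mul hX')).sub ((hX'.const_mul a).mul (hZ.pow 2))).sub
    (((hX.const_mul (2 * a)).mul hZ).mul hZ')).sub (((hZ.pow 2).const_mul (3 * b)).mul hZ')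
  have h2 := h1.congr_of_eventuallyEq (f₁ := fun _ => (0 : ℂ)) (Filter.Eventually.of_forall
    fun t => (h.gradient_deriv t).symm)
  have h3 := h2.unique (hasDerivAt_const t 0)
  rw [← h.hessian_eq]
  simp at h3
  linear_combination h3

theorem exists_generic : ∃ t, Y t * Z t ≠ 0 ∧ weierstrassHessian a b (X t) (Y t) (Z t) ≠ 0 := by
  by_contra! hcon
  have h0 := h.eq_zero_of_mul h.differentiable_hessian fun t => by
    by_cases ht : Y t * Z t = 0
    · rw [ht, zero_mul]
    · rw [hcon t ht, mul_zero]
  refine h.deriv_hessian_ne_zero 0 (h0 0) ?_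
  rw [funext h0, deriv_const]

end IsWeierstrassParametrization

/-! ### A nondegenerate holomorphic map that avoids a Weierstrass cubic -/

/-- The last clause is injectivity of the differential modulo the radial direction, that is,
nondegeneracy of the induced map to ℙ². -/
theorem exists_map_avoiding_weierstrassCubic {a b : ℂ}
    (hs : ∀ x : ℂ, x ^ 3 + a * x + b = 0 → 3 * x ^ 2 + a ≠ 0) :
    ∃ G : (Fin 2 → ℂ) → Fin 3 → ℂ, Differentiable ℂ G ∧
      (∀ z, weierstrassCubic a b (G z 0) (G z 1) (G z 2) ≠ 0) ∧
      ∃ z, ∀ (u : Fin 2 → ℂ) (c : ℂ), fderiv ℂ G z u = c • G z → u = 0 := by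
  obtain ⟨X, Y, Z, hX, hY, hZ, hcubic, hne, hwr, hex⟩ := exists_weierstrass_parametrization hs
  have h : IsWeierstrassParametrization a b X Y Z := ⟨hs, hX, hY, hZ, hcubic, hne, hwr, hex⟩
  obtain ⟨A, hAdef⟩ : ∃ A : ℂ → ℂ, A = fun t => weierstrassHessian a b (X t) (Y t) (Z t) :=
    ⟨_, rfl⟩
  have hA : Differentiable ℂ A := hAdef ▸ h.differentiable_hessian
  have hAe (t : ℂ) : weierstrassHessian a b (X t) (Y t) (Z t) = A t := by rw [hAdef]
  have hsimple : ∀ t, A t = 0 → deriv A t ≠ 0 := by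
    rw [hAdef]
    exact h.deriv_hessian_ne_zero
  have hline (t c : ℂ) : weierstrassCubic a b (c * X t + deriv X t) (c * Y t + deriv Y t)
      (c * Z t + deriv Z t) = c * A t + deriv A t / 3 := by
    rw [hAdef]
    exact h.cubic_tangent t c
  -- The prescribed logarithms give exp g = A'/3 at the zeros of A, so that q below is entire.
  obtain ⟨g, hg, hgA⟩ := exists_entire_interpolation hA hsimple
    fun t => Complex.log (deriv A t / 3)
  obtain ⟨q, hq, hqA⟩ := exists_entire_quotient (h := fun t => Complex.exp (g t) - deriv A t / 3)
    hA (hg.cexp.sub (hA.deriv.div_const 3)) hsimple fun t ht => by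
      rw [hgA t ht, Complex.exp_log (div_ne_zero (hsimple t ht) three_ne_zero), sub_self]
  obtain ⟨φ, hφ, hφe⟩ : ∃ φ : ℂ → ℂ, Differentiable ℂ φ ∧ ∀ w, w * φ w = Complex.exp w - 1 := by
    refine ⟨dslope Complex.exp 0, Complex.differentiable_exp.dslope 0, fun w => ?_⟩
    simpa using sub_smul_dslope Complex.exp 0 w
  -- This is (exp(g + As) − A'/3)/A, split as (exp g − A'/3)/A plus exp g · (exp(As) − 1)/A, both
  -- entire.
  let α (z : Fin 2 → ℂ) : ℂ := q (z 0) + Complex.exp (g (z 0)) * (z 1 * φ (A (z 0) * z 1))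
  have hα : Differentiable ℂ α := by fun_prop
  have hαA (z : Fin 2 → ℂ) : α z * A (z 0) + deriv A (z 0) / 3 =
      Complex.exp (g (z 0) + A (z 0) * z 1) := by
    rw [Complex.exp_add]
    linear_combination hqA (z 0) + Complex.exp (g (z 0)) * hφe (A (z 0) * z 1)
  let V (t : ℂ) : Fin 3 → ℂ := ![X t, Y t, Z t]
  let V' (t : ℂ) : Fin 3 → ℂ := ![deriv X t, deriv Y t, deriv Z t]
  let V'' (t : ℂ) : Fin 3 → ℂ := ![deriv (deriv X) t, deriv (deriv Y) t, deriv (deriv Z) t]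
  have hV (t : ℂ) : HasDerivAt V (V' t) t := by
    rw [hasDerivAt_pi]
    intro i
    fin_cases i
    exacts [(hX t).hasDerivAt, (hY t).hasDerivAt, (hZ t).hasDerivAt]
  have hV' (t : ℂ) : HasDerivAt V' (V'' t) t := by
    rw [hasDerivAt_pi]
    intro i
    fin_cases i
    exacts [(hX.deriv t).hasDerivAt, (hY.deriv t).hasDerivAt, (hZ.deriv t).hasDerivAt]
  have hG (z : Fin 2 → ℂ) : HasFDerivAt (fun z : Fin 2 → ℂ => α z • V (z 0) + V' (z 0))
      (α z • (ContinuousLinearMap.proj (R := ℂ) (φ := fun _ : Fin 2 => ℂ) 0).smulRight (V' (z 0)) +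
        (fderiv ℂ α z).smulRight (V (z 0)) +
        (ContinuousLinearMap.proj (R := ℂ) (φ := fun _ : Fin 2 => ℂ) 0).smulRight (V'' (z 0))) z := by
    have hp : HasFDerivAt (fun z : Fin 2 → ℂ => z 0)
        (ContinuousLinearMap.proj (R := ℂ) (φ := fun _ : Fin 2 => ℂ) 0) z :=
      hasFDerivAt_apply 0 z
    have h1 := (hV (z 0)).hasFDerivAt.comp z hp
    have h2 := (hV' (z 0)).hasFDerivAt.comp z hp
    refine (((hα z).hasFDerivAt.smul h1).add h2).congr_fderiv ?_
    ext1 u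
    simp
  refine ⟨fun z => α z • V (z 0) + V' (z 0), fun z => (hG z).differentiableAt, fun z => ?_, ?_⟩
  · have : weierstrassCubic a b _ _ _ = _ := (hline (z 0) (α z)).trans (hαA z)
    refine ne_of_eq_of_ne this (Complex.exp_ne_zero _)
  · obtain ⟨t, hYZ, hAt⟩ := h.exists_generic
    rw [hAe] at hAt
    refine ⟨![t, 0], fun u c hu => ?_⟩
    rw [(hG _).fderiv] at hu
    have hu0 := congrFun hu 0
    have hu1 := congrFun hu 1
    have hu2 := congrFun hu 2
    simp [V, V', V''] at hu0 hu1 hu2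
    have hgrad := h.gradient_deriv t
    have hgrad2 := h.gradient_deriv_deriv t
    have hW := h.cubic t
    simp only [weierstrassCubic] at hW
    rw [hAe] at hgrad2
    -- Pair with ∇f(V): it annihilates V and V' and takes the value −2A on V''.
    have h0 : u 0 = 0 := by
      have : u 0 * A t = 0 := by
        linear_combination -1 / 2 * ((-3 * X t ^ 2 - a * Z t ^ 2) * hu0 + 2 * Y t * Z t * hu1 +
            (Y t ^ 2 - 2 * a * X t * Z t - 3 * b * Z t ^ 2) * hu2) + u 0 / 2 * hgrad2 +
          (α ![t, 0] * u 0 - c) / 2 * hgrad +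
          3 / 2 * (fderiv ℂ α ![t, 0] u - c * α ![t, 0]) * hW
      simpa [hAt] using this
    rw [h0] at hu0 hu2
    -- What remains is a relation between V and V', which are independent because their XZ-minor is
    -- −2YZ up to sign.
    have hc : c = 0 := by
      have : c * (Y t * Z t) = 0 := by
        linear_combination 1 / 2 * (Z t * hu0 - X t * hu2) + c / 2 * hwr t
      simpa [right_ne_zero_of_mul hYZ, left_ne_zero_of_mul hYZ] using this
    have hβ : fderiv ℂ α ![t, 0] u = 0 := by
      have : fderiv ℂ α ![t, 0] u * Z t = 0 := by
        rw [hc] at hu2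
        linear_combination hu2
      simpa [right_ne_zero_of_mul hYZ] using this
    have hu' : u = u 1 • ![0, 1] := by
      ext i
      fin_cases i <;> simp [h0]
    -- Differentiating αA + A'/3 = exp(g + As) in s shows that ∂α/∂s = exp g ≠ 0 at s = 0.
    have hD : fderiv ℂ α ![t, 0] ![0, 1] * A t = Complex.exp (g t) * A t := by
      have hl : HasDerivAt (fun s : ℂ => ![t, s]) ![0, 1] 0 := by
        rw [hasDerivAt_pi]
        intro i
        fin_cases i
        exacts [hasDerivAt_const _ _, hasDerivAt_id _]
      have h1 := ((hα ![t, 0]).hasFDerivAt.comp_hasDerivAt 0 hl).mul_const (A t)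
      have h2 := ((((hasDerivAt_id (0 : ℂ)).const_mul (A t)).const_add (g t)).cexp).sub_const
        (deriv A t / 3)
      have h3 : (fun s => (α ∘ fun s : ℂ => ![t, s]) s * A t) =
          fun s => Complex.exp (g t + A t * id s) - deriv A t / 3 := by
        funext s
        have := hαA ![t, s]
        simp only [Matrix.cons_val_zero, Matrix.cons_val_one] at this
        simp only [Function.comp_apply, id]
        linear_combination this
      rw [h3] at h1
      simpa using h1.unique h2
    have hD' := mul_right_cancel₀ hAt hD
    have hu1' : u 1 = 0 := by
      rw [hu', map_smul, hD', smul_eq_mul] at hβ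
      simpa using hβ
    rw [hu', hu1', zero_smul]

/-! ### Dominating maps in homogeneous coordinates -/

open ComplexProjective in
/-- A holomorphic map to `ℂⁿ⁺¹ ∖ {0}` that is transverse at some point to the lines through the
origin induces a dominating map. -/
theorem IsDominable.of_homogeneous {n : ℕ} (U : TopologicalSpace.Opens (Pn n))
    {G : (Fin n → ℂ) → Fin (n + 1) → ℂ} (hG : Differentiable ℂ G) (hne : ∀ z, G z ≠ 0)
    (hU : ∀ z, proj n ⟨G z, hne z⟩ ∈ U)
    (hnd : ∃ z, ∀ (u : Fin n → ℂ) (c : ℂ), fderiv ℂ G z u = c • G z → u = 0) :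
    IsDominable n U := by
  let F (z : Fin n → ℂ) : U := ⟨proj n ⟨G z, hne z⟩, hU z⟩
  -- The same choice as in `chartAt`, so that F in charts is definitionally the vector of quotients.
  let i (z : Fin n → ℂ) : Fin (n + 1) := (exists_mem_affineOpen (F z).1).choose
  have hi (z : Fin n → ℂ) : G z (i z) ≠ 0 :=
    (proj_mem_affineOpen (i z) ⟨G z, hne z⟩).1 (exists_mem_affineOpen (F z).1).choose_spec
  have hF : Continuous F :=
    ((isQuotientMap_proj n).continuous.comp (hG.continuous.subtype_mk hne)).subtype_mk hU
  have hGk (z : Fin n → ℂ) (k : Fin (n + 1)) : HasFDerivAt (fun w => G w k)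
      ((ContinuousLinearMap.proj (R := ℂ) (φ := fun _ : Fin (n + 1) => ℂ) k).comp
        (fderiv ℂ G z)) z :=
    (ContinuousLinearMap.proj (R := ℂ) (φ := fun _ : Fin (n + 1) => ℂ) k).hasFDerivAt.comp z
      (hG z).hasFDerivAt
  let D (z : Fin n → ℂ) : (Fin n → ℂ) →L[ℂ] Fin n → ℂ := ContinuousLinearMap.pi fun j =>
    fderiv ℂ (fun w => G w ((i z).succAbove j) / G w (i z)) z
  have hdiff (z : Fin n → ℂ) (j : Fin n) :
      DifferentiableAt ℂ (fun w => G w ((i z).succAbove j) / G w (i z)) z := by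
    have h1 := (hGk z ((i z).succAbove j)).differentiableAt
    have h2 := (hGk z (i z)).differentiableAt
    have h3 := hi z
    simp only [div_eq_mul_inv]
    exact h1.mul (h2.inv h3)
  have hD (z : Fin n → ℂ) : HasMFDerivAt 𝓘(ℂ, Fin n → ℂ) 𝓘(ℂ, Fin n → ℂ) F z (D z) := by
    have key : HasFDerivAt (fun w j => G w ((i z).succAbove j) / G w (i z)) (D z) z :=
      hasFDerivAt_pi.2 fun j => (hdiff z j).hasFDerivAt
    refine ⟨hF.continuousAt, ?_⟩
    have : writtenInExtChartAt 𝓘(ℂ, Fin n → ℂ) 𝓘(ℂ, Fin n → ℂ) z F =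
        fun w j => G w ((i z).succAbove j) / G w (i z) := rfl
    rw [this]
    exact key.hasFDerivWithinAt
  refine ⟨F, fun z => (hD z).mdifferentiableAt, ?_⟩
  obtain ⟨z, hz⟩ := hnd
  refine ⟨z, ?_⟩
  rw [(hD z).mfderiv]
  have hker : LinearMap.ker (D z : (Fin n → ℂ) →ₗ[ℂ] Fin n → ℂ) = ⊥ := by
    rw [LinearMap.ker_eq_bot']
    intro u hu
    -- If all quotients Gₖ/Gᵢ have zero derivative along u, then DG(u) is radial, with factor
    -- DGᵢ(u)/Gᵢ.
    refine hz u (fderiv ℂ G z u (i z) / G z (i z)) (funext fun k => ?_)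
    have h0 := hi z
    refine Fin.succAboveCases (i z) ?_ (fun j => ?_) k
    · simp only [Pi.smul_apply, smul_eq_mul]
      field_simp
    · have h1 := congrFun hu j
      have h2 : fderiv ℂ (fun w => G w ((i z).succAbove j) / G w (i z)) z u = 0 := h1
      have h3 : (fun w => G w ((i z).succAbove j)) =ᶠ[nhds z]
          fun w => G w ((i z).succAbove j) / G w (i z) * G w (i z) := by
        filter_upwards [(hGk z (i z)).continuousAt.eventually_ne h0] with w hw
        rw [div_mul_cancel₀ _ hw]
      have h4 := ((hdiff z j).hasFDerivAt.mul (hGk z (i z))).congr_of_eventuallyEq h3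
      have h5 := DFunLike.congr_fun ((hGk z ((i z).succAbove j)).unique h4) u
      simp only [ContinuousLinearMap.comp_apply, ContinuousLinearMap.proj_apply, add_apply,
        smul_apply, smul_eq_mul, h2, mul_zero, add_zero] at h5
      simp only [Pi.smul_apply, smul_eq_mul, h5]
      ring
  have hunit := (LinearMap.isUnit_iff_ker_eq_bot _).2 hker
  exact ((LinearMap.isUnit_iff_isUnit_det _).1 hunit).ne_zero

end

/-! ### Return from Weierstrass coordinates to the given cubic -/

theorem proposition5p1 (C : Set (ComplexProjective.Pn 2))
    (hC : ComplexProjective.IsSmoothPlaneCurve 3 C) :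
    IsDominable 2
      (⟨Cᶜ, hC.isClosed.isOpen_compl⟩ : TopologicalSpace.Opens (ComplexProjective.Pn 2)) := by
  obtain ⟨f, hf, hCf, hsm⟩ := id hC
  obtain ⟨p, q, r, a, b, c, hc, hli, hfW, hs⟩ := exists_weierstrass_form hf hsm
  obtain ⟨G, hG, hGW, z₀, hz₀⟩ := exists_map_avoiding_weierstrassCubic hs
  let L : (Fin 3 → ℂ) →L[ℂ] Fin 3 → ℂ :=
    (ContinuousLinearMap.proj (R := ℂ) (φ := fun _ : Fin 3 => ℂ) 0).smulRight p +
    (ContinuousLinearMap.proj (R := ℂ) (φ := fun _ : Fin 3 => ℂ) 1).smulRight q +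
    (ContinuousLinearMap.proj (R := ℂ) (φ := fun _ : Fin 3 => ℂ) 2).smulRight r
  have hL (v : Fin 3 → ℂ) : L v = v 0 • p + v 1 • q + v 2 • r := by simp [L]
  have hLinj : Function.Injective L := by
    rw [injective_iff_map_eq_zero]
    intro v hv
    rw [hL] at hv
    obtain ⟨h0, h1, h2⟩ := hli _ _ _ hv
    ext k
    fin_cases k
    exacts [h0, h1, h2]
  have heval (z : Fin 2 → ℂ) : MvPolynomial.eval (L (G z)) f ≠ 0 := by
    rw [hL, hfW]
    exact mul_ne_zero hc (hGW z)
  have hne (z : Fin 2 → ℂ) : L (G z) ≠ 0 := by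
    intro h
    refine hGW z ?_
    have h0 := hLinj (h.trans (map_zero L).symm)
    simp [h0, weierstrassCubic]
  refine IsDominable.of_homogeneous _ (G := fun z => L (G z)) (L.differentiable.comp hG) hne
    (fun z => ?_) ⟨z₀, fun u d hu => ?_⟩
  · change ComplexProjective.proj 2 ⟨L (G z), hne z⟩ ∈ Cᶜ
    rw [hCf]
    exact fun h => heval z (h _ (hne z) rfl)
  · refine hz₀ u d (hLinj ?_)
    have h1 : HasFDerivAt (fun z => L (G z)) (L.comp (fderiv ℂ G z₀)) z₀ :=
      L.hasFDerivAt.comp z₀ (hG z₀).hasFDerivAt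
    rw [h1.fderiv] at hu
    rw [map_smul]
    exact hu
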